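/- For $f\in C^5(\mathbb R)$ write $\alpha_f(z)=3\,(f^{(3)}(z))^2-f^{(4)}(z)\,f''(z)$ for the product-stability of $f$ at $z$. The sharpness of a $C^2$ function $\mathcal L:\mathbb R^2\to\mathbb R$ at a point is the largest eigenvalue of its Hessian there. **Theorem.** Let $l:\mathbb R\to\mathbb R$ be five times continuously differentiable with a local minimum at $z_*$, and suppose $l''(z_*)>0$ and $\alpha_l(z_*)>0$. Then there exist $\eta_0,\sigma,\tau,\delta,C>0$ with $\delta<\tau$ such that the following holds for all $0<\eta\le\eta_0$. Let $\mathcal L(x,y)=l(xy)$, and let $(x_{t+1},y_{t+1})=(x_t,y_t)-\eta\nabla\mathcal L(x_t,y_t)$ be the gradient descent iterates with learning rate $\eta$ from any initialization satisfying $$0<|x_0y_0-z_*|\le\sigma,\qquad 2+\delta\le \eta\, l''(z_*)\,(x_0^2+y_0^2)\le 2+\tau .$$ Then $(x_t,y_t)$ converges to a point $(x_\infty,y_\infty)$ with $x_\infty y_\infty=z_*$, and the sharpness $\lambda$ of $\mathcal L$ at $(x_\infty,y_\infty)$ satisfies $$\left|\lambda-\left(\frac{2}{\eta}-\frac{3\,(l''(z_*))^4}{\alpha_l(z_*)}\,\eta\right)\right|\le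 C\,\eta^{5/3}.$$ -/

import Mathlib

open Filter Topology

noncomputable section

/-- The product-stability `3 (f⁽³⁾(z))² - f⁽⁴⁾(z) f''(z)` of `f` at `z`. -/
def productStability (f : ℝ → ℝ) (z : ℝ) : ℝ :=
  3 * (iteratedDeriv 3 f z) ^ 2 - iteratedDeriv 4 f z * iteratedDeriv 2 f z

/-- The objective `(x, y) ↦ l (x y)` on the Euclidean plane. -/
def productLoss (l : ℝ → ℝ) (p : EuclideanSpace ℝ (Fin 2)) : ℝ :=
  l (p 0 * p 1)

/-- The `t`-th iterate of gradient descent on `L` with learning rate `η`, started at `p₀`. -/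
def gradientDescent (L : EuclideanSpace ℝ (Fin 2) → ℝ) (η : ℝ)
    (p₀ : EuclideanSpace ℝ (Fin 2)) : ℕ → EuclideanSpace ℝ (Fin 2)
  | 0 => p₀
  | t + 1 => gradientDescent L η p₀ t - η • gradient L (gradientDescent L η p₀ t)

/-- The Hessian of `L` at `p`, as the linear operator obtained by differentiating the gradient. -/
def hessian (L : EuclideanSpace ℝ (Fin 2) → ℝ) (p : EuclideanSpace ℝ (Fin 2)) :
    EuclideanSpace ℝ (Fin 2) →L[ℝ] EuclideanSpace ℝ (Fin 2) :=
  fderiv ℝ (gradient L) p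

/-- `lam` is the sharpness of `L` at `p`: the largest eigenvalue of the Hessian of `L` at `p`. -/
def IsSharpness (L : EuclideanSpace ℝ (Fin 2) → ℝ) (p : EuclideanSpace ℝ (Fin 2))
    (lam : ℝ) : Prop :=
  IsGreatest
    {μ : ℝ | Module.End.HasEigenvalue
      (hessian L p : EuclideanSpace ℝ (Fin 2) →ₗ[ℝ] EuclideanSpace ℝ (Fin 2)) μ} lam

end

/-! Write w = xy − z and g = l', and let a, b, c be the second, third and fourth derivatives of l at
z. A gradient step multiplies x² − y² by exactly 1 − η²g². Hence v = ηa√((x² − y²)² + 4z²) − 2, the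
excess over 2 of η times the sharpness at the matching minimizer, drifts slowly. Meanwhile w
undergoes a map with multiplier close to −(1 + v): a flip bifurcation with a drifting parameter. The
variable q = w + (b/2a)w² removes the quadratic term and leaves q ↦ −q(1 + v − Kq²) with K =
α/(3a²). Positive product-stability thus says that the bifurcation is supercritical. With r = √K|q|
and e = a²η²/K = 3a⁴η²/α, the model is r' ≈ r(1 + v − r²), v' ≈ v − 2er².

To leading order the defect D = r² − v − e is multiplied by 1 − 2r² at each step. The orbit is drawn
to the curve r² = v + e and slides down it until r dies out near v = −e. So ηλ = 2 − e + O(e^{3/2}),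
and dividing by η gives the claim, even with error O(η²).

The contraction degenerates as r → 0, so there is no uniform rate. Instead |D| is kept below a
barrier in v, 175M(v + 10e)^{3/2} + (ε²/2)exp((v − v₀)/(2e)). The first term absorbs the model
errors, the second the initial defect. In the model D decays like exp(v/e) as v falls; asking for
half that rate leaves slack. `slow_passage_step` propagates the barrier, `slow_passage` passes to
the limit, and `exists_gradient_slowStep` shows that gradient descent obeys the recurrence with
constants independent of η. The limit of v is strictly negative, so r is summable and the iterates
converge. -/

/-! ### Slow passage through a flip bifurcation: the model recurrence. -/

set_option maxHeartbeats 1000000 in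
/-- One step of the slow passage through a flip bifurcation: the deviation `r² - v - e` from the
slow curve stays inside the barrier `175 M m³ + k²`. -/
lemma slow_passage_step {M ε e r v r' v' m m' k H' : ℝ} (hM : 1 ≤ M) (hε : 350 * M * ε ≤ 1)
    (he : 0 < e) (hm : 0 < m) (hm' : 0 ≤ m') (hmv : m ^ 2 = v + 10 * e)
    (hmv' : m' ^ 2 = v' + 10 * e) (hv3 : -3 * e ≤ v) (hk : 0 ≤ k) (hmε : m ≤ ε) (hkε : k ≤ ε)
    (hr0 : 0 < r) (hr : |r' - r * (1 + v - r ^ 2)| ≤ M * r ^ 2 * (|v| + r ^ 2 + e))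
    (hv : |v' - (v - 2 * e * r ^ 2)| ≤ M * e * r ^ 2 * (r + |v| + e))
    (hV : |r ^ 2 - v - e| ≤ 175 * M * m ^ 3 + k ^ 2)
    (hH' : k ^ 2 * (1 - (v - v') / (2 * e)) ≤ H') :
    0 < r' ∧ |r' ^ 2 - v' - e| ≤ 175 * M * m' ^ 3 + H' ∧
      1.99 * e * r ^ 2 ≤ v - v' := by
  -- `μ` is the larger of `m` and `k`: a single scale for all errors, whose cube splits back into
  -- the two barrier terms.
  obtain ⟨μ, hμm, hμk, hμε, hμ3⟩ : ∃ μ, m ≤ μ ∧ k ≤ μ ∧ μ ≤ ε ∧ μ ^ 3 ≤ m ^ 3 + k ^ 3 := by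
    rcases le_total m k with h | h
    · exact ⟨k, h, le_rfl, hkε, by have := pow_pos hm 3; linarith⟩
    · exact ⟨m, le_rfl, h, hmε, by have := pow_nonneg hk 3; linarith⟩
  have hμ0 : 0 < μ := hm.trans_le hμm
  have hMx : ∀ x, x ≤ ε → M * x ≤ 1 / 350 := fun x hx => by
    have : M * x ≤ M * ε := by gcongr
    linarith
  have hMμ := hMx μ hμε
  have hMm := hMx m hmε
  have hMk := hMx k hkε
  have hμ1 : μ ≤ 1 / 350 := (le_mul_of_one_le_left hμ0.le hM).trans hMμ
  have hm2 : m ^ 2 ≤ μ ^ 2 := by gcongr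
  have hk2 : k ^ 2 ≤ μ ^ 2 := by gcongr
  have hav : |v| ≤ μ ^ 2 := abs_le.2 ⟨by linarith, by linarith⟩
  have heμ : e ≤ m ^ 2 / 7 := by linarith
  have hm3 : 175 * M * m ^ 3 ≤ m ^ 2 / 2 := by
    have : 175 * M * m ^ 3 = 175 * (M * m) * m ^ 2 := by ring
    rw [this, div_eq_inv_mul]; gcongr; linarith
  have hr2 : r ^ 2 ≤ 3 * μ ^ 2 := by
    have := (abs_le.1 hV).2
    linarith
  have hrμ : r ≤ 2 * μ := by
    by_contra h
    push Not at h
    have : (2 * μ) ^ 2 < r ^ 2 := by gcongr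
    linarith [pow_pos hμ0 2]
  have hμ2 : μ ^ 2 ≤ μ * (1 / 350) := by rw [sq]; gcongr
  set N := |v| + r ^ 2 + e with hN
  set n := r + |v| + e with hn
  have hv0 := abs_nonneg v
  have hr20 : 0 < r ^ 2 := by positivity
  have hN0 : 0 ≤ N := by positivity
  have hn0 : 0 ≤ n := by positivity
  have hN5 : N ≤ 5 * μ ^ 2 := by linarith
  have hn3 : n ≤ 3 * μ := by linarith
  have hrn : r ≤ n := by linarith
  have hr1 : r ≤ 1 := by linarith
  have hNn : N ≤ n := by
    have : r ^ 2 ≤ r * 1 := by rw [sq]; gcongr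
    linarith
  have hM0 : 0 < M := by linarith
  have hMn : M * n ≤ 3 / 350 := by
    have : M * n ≤ M * (3 * μ) := by gcongr
    linarith
  have hNs : N ≤ 1 / 100 := by linarith
  set X := v - r ^ 2 with hX
  have hXN : |X| ≤ N := by
    rw [hX]; exact (abs_sub _ _).trans (by rw [abs_of_pos hr20]; linarith)
  -- `E`, and `J` below, are errors relative to r and r², so that every error in the defect
  -- recursion carries a factor r², like the contraction itself.
  obtain ⟨E, hE⟩ : ∃ E, r' = r * (1 + X + E) := ⟨r' / r - 1 - X, by field_simp; ring⟩
  have hEb : |E| ≤ M * n * N := by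
    have h1 : r' - r * (1 + v - r ^ 2) = r * E := by rw [hE, hX]; ring
    rw [h1, abs_mul, abs_of_pos hr0] at hr
    have h2 : r * |E| ≤ r * (M * r * N) := by linarith [hr, show M * r ^ 2 * N = r * (M * r * N) by ring]
    have h3 := le_of_mul_le_mul_left h2 hr0
    have : M * r * N ≤ M * n * N := by gcongr
    linarith
  have hEs : |E| ≤ 1 / 100 := by
    have : M * n * N ≤ 3 / 350 * (1 / 100) := by gcongr
    linarith
  obtain ⟨hE1, hE2⟩ := abs_le.1 hEs
  obtain ⟨hX1, hX2⟩ := abs_le.1 (hXN.trans hNs)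
  have hvh : |v' - (v - 2 * e * r ^ 2)| ≤ (e * r ^ 2) * (1 / 100) := by
    refine hv.trans ?_
    have : M * e * r ^ 2 * n = (e * r ^ 2) * (M * n) := by ring
    rw [this]
    gcongr
    linarith
  obtain ⟨hvh1, hvh2⟩ := abs_le.1 hvh
  obtain ⟨J, hJ⟩ : ∃ J, v' = v - 2 * e * r ^ 2 + r ^ 2 * J :=
    ⟨(v' - (v - 2 * e * r ^ 2)) / r ^ 2, by field_simp; ring⟩
  have hJb : |J| ≤ M * n * N := by
    have h1 : v' - (v - 2 * e * r ^ 2) = r ^ 2 * J := by rw [hJ]; ring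
    rw [h1, abs_mul, abs_of_pos hr20] at hv
    have h2 : r ^ 2 * |J| ≤ r ^ 2 * (M * n * e) := by
      linarith [hv, show M * e * r ^ 2 * n = r ^ 2 * (M * n * e) by ring]
    have h3 := le_of_mul_le_mul_left h2 hr20
    have : M * n * e ≤ M * n * N := by gcongr; linarith
    linarith
  have hpos : 0 < r' := by rw [hE]; apply mul_pos hr0; linarith
  set F := X ^ 2 + 2 * E * (1 + X) + E ^ 2 - J with hF
  have hFb : |F| ≤ 7 * (M * n * N) := by
    have h1 : X ^ 2 ≤ M * n * N := by
      rw [← sq_abs]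
      have : |X| ^ 2 ≤ n * N := by rw [sq]; gcongr; linarith
      have : n * N ≤ M * n * N := by
        rw [mul_assoc]; exact le_mul_of_one_le_left (by positivity) hM
      linarith
    have h2 : |2 * E * (1 + X)| ≤ 4 * |E| := by
      rw [abs_mul, abs_mul, abs_two]
      have : |1 + X| ≤ 2 := abs_le.2 ⟨by linarith, by linarith⟩
      calc 2 * |E| * |1 + X| ≤ 2 * |E| * 2 := by gcongr
        _ = 4 * |E| := by ring
    have h3 : E ^ 2 ≤ |E| := by
      rw [← sq_abs, sq]
      exact mul_le_of_le_one_left (abs_nonneg E) (by linarith)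
    obtain ⟨h4, h5⟩ := abs_le.1 h2
    obtain ⟨h6, h7⟩ := abs_le.1 hJb
    have h8 := sq_nonneg X
    have h9 := sq_nonneg E
    exact abs_le.2 ⟨by linarith, by linarith⟩
  have hFb' : |F| ≤ 105 * M * (m ^ 3 + k ^ 3) := by
    have h1 : M * n * N ≤ M * (3 * μ) * (5 * μ ^ 2) := by gcongr
    have h2 : M * μ ^ 3 ≤ M * (m ^ 3 + k ^ 3) := by gcongr
    have h3 : M * (3 * μ) * (5 * μ ^ 2) = 15 * (M * μ ^ 3) := by ring
    linarith
  have hk3 : 105 * M * k ^ 3 ≤ 3 / 10 * k ^ 2 := by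
    have : 105 * M * k ^ 3 = 105 * (M * k) * k ^ 2 := by ring
    rw [this]; gcongr; linarith
  refine ⟨hpos, ?_, by linarith⟩
  -- The drift supplies the 2er² that completes 2r²(v − r²) to −2r² times the defect; this is why
  -- the slow curve is shifted by e.
  have hid : r' ^ 2 - v' - e = (r ^ 2 - v - e) * (1 - 2 * r ^ 2) + r ^ 2 * F := by
    rw [hE, hJ, hF, hX]; ring
  have hp1 : 0 ≤ 1 - 2 * r ^ 2 := by linarith
  have hstep : |r' ^ 2 - v' - e| ≤
      (175 * M * m ^ 3 + k ^ 2) * (1 - 2 * r ^ 2) + r ^ 2 * (105 * M * (m ^ 3 + k ^ 3)) := by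
    rw [hid]
    refine (abs_add_le _ _).trans ?_
    rw [abs_mul, abs_mul, abs_of_nonneg hp1, abs_of_pos hr20]
    gcongr
  -- This term may shrink by a factor of about 1 − r² only, while the defect contracts by 1 − 2r²;
  -- the gap pays for the k³ error.
  have hH : k ^ 2 * (1 - 1.1 * r ^ 2) ≤ H' := by
    refine le_trans ?_ hH'
    gcongr
    rw [div_le_iff₀ (by positivity)]
    linarith [mul_pos he hr20]
  -- Tangent-line bound for the convex function s ↦ s^{3/2} at s = m².
  have hm'3 : m ^ 3 - 3 / 2 * m * (v - v') ≤ m' ^ 3 := by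
    have h1 : v - v' = m ^ 2 - m' ^ 2 := by linarith
    rw [h1]
    have h2 : 0 ≤ (m - m') ^ 2 * (m + 2 * m') := by positivity
    linarith
  -- The shift by 10e in m² gives e ≤ m²/7, so m³ loses less than the fraction r²/2. Against the
  -- contraction 2r² this leaves 175 · 3/2, more than the 105 in the error.
  have hm3' : m ^ 3 * (1 - r ^ 2 / 2) ≤ m' ^ 3 := by
    refine le_trans ?_ hm'3
    have h1 : m * (v - v') ≤ m * (2.01 * (m ^ 2 / 7) * r ^ 2) := by
      gcongr
      exact (show v - v' ≤ 2.01 * e * r ^ 2 by linarith).trans (by gcongr)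
    linarith [mul_pos (pow_pos hm 3) hr20]
  have hA : 175 * M * (m ^ 3 * (1 - r ^ 2 / 2)) ≤ 175 * M * m' ^ 3 := by gcongr
  have hB : 0 ≤ M * m ^ 3 * r ^ 2 := by positivity
  have hC : 0 ≤ k ^ 2 * r ^ 2 := by positivity
  have hD : 105 * M * k ^ 3 * r ^ 2 ≤ 3 / 10 * k ^ 2 * r ^ 2 := by gcongr
  linarith

/-- Polynomial decay suffices: it makes the memory of the initial defect O(e²). -/
lemma exp_neg_le_two_div_sq {x : ℝ} (hx : 0 < x) : Real.exp (-x) ≤ 2 / x ^ 2 := by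
  rw [Real.exp_neg, inv_eq_one_div, div_le_div_iff₀ (Real.exp_pos x) (by positivity)]
  linarith [Real.quadratic_le_exp_of_nonneg hx.le]

/-- The barrier is small compared with `e` once the slow variable has reached `v ≤ e`. -/
lemma barrier_le {M ε e v v₀ : ℝ} (hM : 1 ≤ M) (hε0 : 0 < ε) (hε : 350 * M * ε ≤ 1)
    (he : 0 < e) (heε : e ≤ ε ^ 2 / 10000) (hv3 : -3 * e ≤ v) (hve : v ≤ e)
    (hv0 : ε ^ 2 / 16 ≤ v₀) :
    175 * M * √(v + 10 * e) ^ 3 + ε ^ 2 / 2 * Real.exp ((v - v₀) / (2 * e)) ≤ 6 / 10 * e := by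
  have hm0 := Real.sqrt_nonneg (v + 10 * e)
  have hm2 : √(v + 10 * e) ^ 2 = v + 10 * e := Real.sq_sqrt (by linarith)
  have hmε : √(v + 10 * e) ≤ ε / 30 := by
    rw [Real.sqrt_le_left (by positivity)]
    nlinarith
  have h1 : 175 * M * √(v + 10 * e) ^ 3 ≤ 11 / 60 * e := by
    have h : 175 * M * √(v + 10 * e) ≤ 1 / 60 := by
      calc 175 * M * √(v + 10 * e) ≤ 175 * M * (ε / 30) := by gcongr
        _ ≤ 1 / 60 := by linarith
    calc 175 * M * √(v + 10 * e) ^ 3 = 175 * M * √(v + 10 * e) * √(v + 10 * e) ^ 2 := by ring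
      _ ≤ 1 / 60 * (11 * e) := by
        rw [hm2]
        exact mul_le_mul h (by linarith) (by linarith) (by norm_num)
      _ = 11 / 60 * e := by ring
  have h2 : Real.exp ((v - v₀) / (2 * e)) ≤ 2 / (ε ^ 2 / (64 * e)) ^ 2 := by
    refine le_trans (Real.exp_le_exp.2 ?_) (exp_neg_le_two_div_sq (by positivity))
    rw [neg_eq_neg_one_mul, ← mul_div_assoc, div_le_div_iff₀ (by positivity) (by positivity)]
    nlinarith
  have h3 : ε ^ 2 / 2 * Real.exp ((v - v₀) / (2 * e)) ≤ 4096 / 10000 * e := by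
    calc _ ≤ ε ^ 2 / 2 * (2 / (ε ^ 2 / (64 * e)) ^ 2) := by gcongr
      _ = 4096 * e / ε ^ 2 * e := by field_simp; norm_num
      _ ≤ 4096 / 10000 * e := by
        have : 4096 * e / ε ^ 2 ≤ 4096 / 10000 := by
          rw [div_le_iff₀ (by positivity)]
          linarith
        gcongr
  linarith

/-- The invariant carried along the orbit during the slow passage. -/
structure SlowBarrier (M ε e v₀ r v : ℝ) : Prop where
  pos : 0 < r
  le_v : -3 * e ≤ v
  v_le : v ≤ v₀
  bound : |r ^ 2 - v - e| ≤
    175 * M * √(v + 10 * e) ^ 3 + ε ^ 2 / 2 * Real.exp ((v - v₀) / (2 * e))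

/-- The recurrence inequalities satisfied by one step of the slow passage. -/
structure SlowStep (M e r v r' v' : ℝ) : Prop where
  fast : |r' - r * (1 + v - r ^ 2)| ≤ M * r ^ 2 * (|v| + r ^ 2 + e)
  slow : |v' - (v - 2 * e * r ^ 2)| ≤ M * e * r ^ 2 * (r + |v| + e)

/-- At v = v₀ the exponential equals 1, and ε²/2 alone covers the initial defect. -/
lemma SlowBarrier.init {M ε e r v : ℝ} (hM : 1 ≤ M)
    (he : 0 < e) (heε : e ≤ ε ^ 2 / 10000) (hr : 0 < r)
    (hrε : r ≤ ε / 4) (hv : ε ^ 2 / 16 ≤ v) (hv' : v ≤ ε ^ 2 / 8) :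
    SlowBarrier M ε e v r v where
  pos := hr
  le_v := by nlinarith
  v_le := le_rfl
  bound := by
    have h1 : 0 ≤ 175 * M * √(v + 10 * e) ^ 3 := by positivity
    have h2 : r ^ 2 ≤ (ε / 4) ^ 2 := by gcongr
    have h3 := sq_nonneg r
    simp only [sub_self, zero_div, Real.exp_zero]
    exact abs_le.2 ⟨by nlinarith, by nlinarith⟩

/-- Each barrier term is at most ε²/2, so the orbit stays in the window where the recurrence is
available. -/
lemma SlowBarrier.region {M ε e v₀ r v : ℝ} (hM : 1 ≤ M) (hε0 : 0 < ε) (hε : 350 * M * ε ≤ 1)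
    (he : 0 < e) (heε : e ≤ ε ^ 2 / 10000) (hv0 : v₀ ≤ ε ^ 2 / 8)
    (h : SlowBarrier M ε e v₀ r v) :
    r ≤ 2 * ε ∧ |v| ≤ ε := by
  have hε1 : ε ≤ 1 / 350 := by nlinarith
  have h1 := h.le_v
  have h2 := h.v_le
  have hm0 := Real.sqrt_nonneg (v + 10 * e)
  have hmε : √(v + 10 * e) ≤ ε := by
    rw [Real.sqrt_le_left (by positivity)]
    nlinarith
  have hε2 : ε ^ 2 ≤ ε := by nlinarith
  refine ⟨?_, abs_le.2 ⟨by linarith, by linarith⟩⟩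
  have h3 := (abs_le.1 h.bound).2
  have h4 : Real.exp ((v - v₀) / (2 * e)) ≤ 1 := by
    rw [Real.exp_le_one_iff]
    exact div_nonpos_of_nonpos_of_nonneg (by linarith) (by positivity)
  have h5 : ε ^ 2 / 2 * Real.exp ((v - v₀) / (2 * e)) ≤ ε ^ 2 / 2 * 1 := by gcongr
  have h6 : 175 * M * √(v + 10 * e) ^ 3 ≤ 175 * M * ε ^ 3 := by gcongr
  have h7 : 175 * M * ε ^ 3 ≤ ε ^ 2 / 2 := by nlinarith [sq_nonneg ε]
  have h8 : r ^ 2 ≤ (2 * ε) ^ 2 := by linarith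
  exact (sq_le_sq₀ h.pos.le (by positivity)).1 h8

/-- Beyond the one-step estimate, the floor −3e must survive. Where v ≤ e the barrier is at most
0.6e, so r² ≥ 0 forces v ≥ −1.6e, and a step lowers v by at most e. -/
lemma SlowBarrier.step {M ε e v₀ r v r' v' : ℝ} (hM : 1 ≤ M) (hε0 : 0 < ε)
    (hε : 350 * M * ε ≤ 1) (he : 0 < e) (heε : e ≤ ε ^ 2 / 10000) (hv0 : ε ^ 2 / 16 ≤ v₀)
    (hv0' : v₀ ≤ ε ^ 2 / 8) (h : SlowBarrier M ε e v₀ r v) (hs : SlowStep M e r v r' v') :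
    SlowBarrier M ε e v₀ r' v' ∧ 1.99 * e * r ^ 2 ≤ v - v' := by
  have hε1 : ε ≤ 1 / 350 := by nlinarith
  have h1 := h.le_v
  have h2 := h.v_le
  have hr0 := h.pos
  obtain ⟨hr2, hvε⟩ := h.region hM hε0 hε he heε hv0'
  have hmε : √(v + 10 * e) ≤ ε := by
    rw [Real.sqrt_le_left (by positivity)]
    nlinarith
  have hm : 0 < √(v + 10 * e) := Real.sqrt_pos.2 (by linarith)
  have hm2 : √(v + 10 * e) ^ 2 = v + 10 * e := Real.sq_sqrt (by linarith)
  have hv'3 : -3 * e ≤ v' := by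
    have h3 : v' ≥ v - 2 * e * r ^ 2 - M * e * r ^ 2 * (r + |v| + e) := by
      linarith [(abs_le.1 hs.slow).1]
    have h4 : M * e * r ^ 2 * (r + |v| + e) ≤ M * e * r ^ 2 * (2 * ε + ε + ε) := by
      have : e ≤ ε := by nlinarith
      gcongr
    have h5 : M * e * r ^ 2 * (2 * ε + ε + ε) ≤ e * r ^ 2 := by
      have : M * e * r ^ 2 * (2 * ε + ε + ε) = e * r ^ 2 * (4 * (M * ε)) := by ring
      rw [this]
      exact mul_le_of_le_one_right (by positivity) (by linarith)
    have h6 : r ^ 2 ≤ 1 / 3 := by nlinarith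
    have h7 : e * r ^ 2 ≤ e * (1 / 3) := by gcongr
    rcases le_total v e with hve | hve
    · have h8 := h.bound.trans (barrier_le hM hε0 hε he heε h1 hve hv0)
      have := (abs_le.1 h8).2
      have := pow_pos hr0 2
      linarith
    · linarith
  set k := √(ε ^ 2 / 2 * Real.exp ((v - v₀) / (2 * e))) with hk
  have hk2 : k ^ 2 = ε ^ 2 / 2 * Real.exp ((v - v₀) / (2 * e)) := Real.sq_sqrt (by positivity)
  have hkε : k ≤ ε := by
    rw [hk, Real.sqrt_le_left hε0.le]
    have h4 : Real.exp ((v - v₀) / (2 * e)) ≤ 1 := by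
      rw [Real.exp_le_one_iff]
      exact div_nonpos_of_nonpos_of_nonneg (by linarith) (by positivity)
    nlinarith [sq_nonneg ε]
  have hbound := h.bound
  rw [← hk2] at hbound
  obtain ⟨g1, g2, g3⟩ := slow_passage_step (m' := √(v' + 10 * e))
    (H' := ε ^ 2 / 2 * Real.exp ((v' - v₀) / (2 * e))) hM hε he hm (Real.sqrt_nonneg _) hm2
    (Real.sq_sqrt (by linarith)) h1 (Real.sqrt_nonneg _) hmε hkε hr0 hs.fast hs.slow hbound (by
      rw [hk2, mul_assoc]
      gcongr
      have h9 : (v' - v₀) / (2 * e) = (v - v₀) / (2 * e) + -((v - v') / (2 * e)) := by ring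
      rw [h9, Real.exp_add]
      gcongr
      linarith [Real.add_one_le_exp (-((v - v') / (2 * e)))])
  have : 0 ≤ 1.99 * e * r ^ 2 := by positivity
  exact ⟨⟨g1, hv'3, by linarith, g2⟩, g3⟩

/-- Slow passage through a supercritical flip bifurcation. The amplitude `r` first grows along the
slow curve `r² = v + e` while the parameter `v` drifts downwards at speed `2 e r²`, and eventually
dies out, leaving `v` at `-e + O(e^{3/2})`. -/
lemma slow_passage {M ρ : ℝ} (hM : 1 ≤ M) (hρ : 0 < ρ) :
    ∃ δ τ σ e₀ C : ℝ, 0 < δ ∧ δ < τ ∧ 0 < σ ∧ 0 < e₀ ∧ 0 < C ∧ ∀ e, 0 < e → e ≤ e₀ →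
      ∀ (r v : ℕ → ℝ) (G : ℕ → Prop), G 0 → 0 < r 0 → r 0 ≤ σ → δ ≤ v 0 → v 0 ≤ τ →
        (∀ t, G t → 0 < r t → r t ≤ ρ → |v t| ≤ ρ →
          G (t + 1) ∧ SlowStep M e (r t) (v t) (r (t + 1)) (v (t + 1))) →
        (∀ t, G t ∧ 0 < r t ∧ r t ≤ ρ ∧ |v t| ≤ ρ) ∧ Summable r ∧
          ∃ vlim, Tendsto v atTop (𝓝 vlim) ∧ |vlim + e| ≤ C * (e * √e) := by
  obtain ⟨ε, hε0, hε, hερ⟩ : ∃ ε, 0 < ε ∧ 350 * M * ε ≤ 1 ∧ 2 * ε ≤ ρ := by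
    refine ⟨min (1 / (350 * M)) (ρ / 2), by positivity, ?_, ?_⟩
    · calc 350 * M * min (1 / (350 * M)) (ρ / 2) ≤ 350 * M * (1 / (350 * M)) := by
            gcongr; exact min_le_left _ _
        _ = 1 := by field_simp
    · linarith [min_le_right (1 / (350 * M)) (ρ / 2)]
  have hε1 : ε ≤ 1 / 350 := by nlinarith
  refine ⟨ε ^ 2 / 16, ε ^ 2 / 8, ε / 4, ε ^ 2 / 10000, 175 * M * 40 + 1024 / ε ^ 2,
    by positivity, by nlinarith [pow_pos hε0 2], by positivity, by positivity, by positivity, ?_⟩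
  intro e he heε r v G hG hr0 hrσ hvδ hvτ hstep
  have hB : ∀ t, G t ∧ SlowBarrier M ε e (v 0) (r t) (v t) := by
    intro t
    induction t with
    | zero => exact ⟨hG, SlowBarrier.init hM he heε hr0 hrσ hvδ hvτ⟩
    | succ t ih =>
      obtain ⟨h1, h2⟩ := ih.2.region hM hε0 hε he heε hvτ
      obtain ⟨h3, h4⟩ := hstep t ih.1 ih.2.pos (by linarith) (by linarith)
      exact ⟨h3, (ih.2.step hM hε0 hε he heε hvδ hvτ h4).1⟩
  have hreg : ∀ t, G t ∧ 0 < r t ∧ r t ≤ ρ ∧ |v t| ≤ ρ := fun t => by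
    obtain ⟨h1, h2⟩ := (hB t).2.region hM hε0 hε he heε hvτ
    exact ⟨(hB t).1, (hB t).2.pos, by linarith, by linarith⟩
  have hS : ∀ t, SlowStep M e (r t) (v t) (r (t + 1)) (v (t + 1)) := fun t =>
    (hstep t (hreg t).1 (hreg t).2.1 (hreg t).2.2.1 (hreg t).2.2.2).2
  have hdrop : ∀ t, 1.99 * e * r t ^ 2 ≤ v t - v (t + 1) := fun t =>
    ((hB t).2.step hM hε0 hε he heε hvδ hvτ (hS t)).2
  have hanti : Antitone v := antitone_nat_of_succ_le fun t => by
    have : 0 ≤ 1.99 * e * r t ^ 2 := by positivity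
    linarith [hdrop t]
  obtain ⟨vl, hvl⟩ : ∃ vl, Tendsto v atTop (𝓝 vl) :=
    ⟨_, tendsto_atTop_ciInf hanti ⟨-3 * e, by rintro _ ⟨t, rfl⟩; exact (hB t).2.le_v⟩⟩
  have hvl3 : -3 * e ≤ vl := ge_of_tendsto' hvl fun t => (hB t).2.le_v
  have hr2 : Tendsto (fun t => r t ^ 2) atTop (𝓝 0) := by
    have h1 : Tendsto (fun t => (v t - v (t + 1)) / (1.99 * e)) atTop (𝓝 0) := by
      have := (hvl.sub (hvl.comp (tendsto_add_atTop_nat 1))).div_const (1.99 * e)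
      simpa using this
    refine squeeze_zero (fun t => sq_nonneg _) (fun t => ?_) h1
    rw [le_div_iff₀ (by positivity)]
    linarith [hdrop t]
  have hr : Tendsto r atTop (𝓝 0) := by
    have := hr2.sqrt
    simp only [Real.sqrt_zero] at this
    refine this.congr fun t => Real.sqrt_sq (hB t).2.pos.le
  have hbarrier : |0 - vl - e| ≤
      175 * M * √(vl + 10 * e) ^ 3 + ε ^ 2 / 2 * Real.exp ((vl - v 0) / (2 * e)) := by
    refine le_of_tendsto_of_tendsto' (((hr2.sub hvl).sub_const e).abs) ?_ fun t => (hB t).2.bound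
    refine Tendsto.add (((hvl.add_const _).sqrt.pow 3).const_mul _) (Tendsto.const_mul _ ?_)
    exact ((hvl.sub_const _).div_const _).rexp
  have hfast : ∀ t, |r (t + 1) / r t - (1 + v t - r t ^ 2)| ≤ M * r t * (|v t| + r t ^ 2 + e) :=
    fun t => by
    have h0 := (hB t).2.pos
    have h1 := (hS t).fast
    have h2 : r (t + 1) - r t * (1 + v t - r t ^ 2) =
        r t * (r (t + 1) / r t - (1 + v t - r t ^ 2)) := by field_simp
    rw [h2, abs_mul, abs_of_pos h0] at h1
    refine le_of_mul_le_mul_left (h1.trans (le_of_eq ?_)) h0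
    ring
  have hlow : Tendsto (fun t => v t - r t ^ 2 - M * r t * (|v t| + r t ^ 2 + e)) atTop (𝓝 vl) := by
    have := (hvl.sub hr2).sub ((hr.const_mul M).mul ((hvl.abs.add hr2).add_const e))
    simpa using this
  have hupp : Tendsto (fun t => v t - r t ^ 2 + M * r t * (|v t| + r t ^ 2 + e)) atTop (𝓝 vl) := by
    have := (hvl.sub hr2).add ((hr.const_mul M).mul ((hvl.abs.add hr2).add_const e))
    simpa using this
  -- A positive limit would make the growth factor of r eventually at least 1, contradicting r → 0.
  have hvl0 : vl ≤ 0 := by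
    by_contra! hpos
    obtain ⟨T, hT⟩ := eventually_atTop.1 (hlow.eventually (lt_mem_nhds hpos))
    have hmono : ∀ n, r T ≤ r (T + n) := fun n => by
      induction n with
      | zero => simp
      | succ n ih =>
        refine ih.trans ?_
        have h0 := (hB (T + n)).2.pos
        have h1 := (abs_le.1 (hfast (T + n))).1
        have h2 := hT (T + n) (by omega)
        have h3 : 1 ≤ r (T + n + 1) / r (T + n) := by linarith
        rwa [one_le_div h0] at h3
    have h1 : Tendsto (fun n => r (T + n)) atTop (𝓝 0) := by
      have := hr.comp (tendsto_add_atTop_nat T)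
      refine this.congr fun n => by simp [add_comm]
    exact absurd (ge_of_tendsto' h1 hmono) (not_le.2 (hB T).2.pos)
  -- At r = 0 the barrier bound 0.6e gives vl ≤ −0.4e, so the ratios of successive r have a limit
  -- below 1.
  have hvlneg : vl < -(e / 5) := by
    have h1 := hbarrier.trans (barrier_le hM hε0 hε he heε hvl3 (by linarith) hvδ)
    linarith [(abs_le.1 h1).1]
  refine ⟨hreg, ?_, vl, hvl, ?_⟩
  · have hq : 1 - e / 5 < 1 := by linarith
    refine summable_of_ratio_norm_eventually_le hq ?_
    filter_upwards [hupp.eventually (gt_mem_nhds hvlneg)] with t ht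
    have h0 := (hB t).2.pos
    rw [Real.norm_of_nonneg h0.le, Real.norm_of_nonneg (hB (t + 1)).2.pos.le, ← div_le_iff₀ h0]
    linarith [(abs_le.1 (hfast t)).2]
  · have h1 : |vl + e| = |0 - vl - e| := by rw [← abs_neg]; ring_nf
    have hse : √e ^ 2 = e := Real.sq_sqrt he.le
    have hse0 : 0 < √e := Real.sqrt_pos.2 he
    have h2 : √(vl + 10 * e) ≤ 3.2 * √e := by
      rw [Real.sqrt_le_left (by positivity), mul_pow, hse]
      linarith
    have h3 : √(vl + 10 * e) ^ 3 ≤ 40 * (e * √e) := by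
      calc _ ≤ (3.2 * √e) ^ 3 := by gcongr
        _ = 3.2 ^ 3 * (√e ^ 2 * √e) := by ring
        _ ≤ _ := by rw [hse]; gcongr; norm_num
    have h4 : Real.exp ((vl - v 0) / (2 * e)) ≤ 2 / (ε ^ 2 / (32 * e)) ^ 2 := by
      refine le_trans (Real.exp_le_exp.2 ?_) (exp_neg_le_two_div_sq (by positivity))
      rw [neg_eq_neg_one_mul, ← mul_div_assoc, div_le_div_iff₀ (by positivity) (by positivity)]
      nlinarith
    have he1 : √e ≤ 1 := by exact Real.sqrt_le_iff.2 ⟨zero_le_one, by nlinarith⟩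
    have h5 : ε ^ 2 / 2 * Real.exp ((vl - v 0) / (2 * e)) ≤ 1024 / ε ^ 2 * (e * √e) := by
      calc _ ≤ ε ^ 2 / 2 * (2 / (ε ^ 2 / (32 * e)) ^ 2) := by gcongr
        _ = 1024 / ε ^ 2 * (e * √e ^ 2) := by rw [hse]; field_simp; norm_num
        _ ≤ _ := by gcongr; rw [sq]; exact mul_le_of_le_one_left hse0.le he1
    rw [h1]
    have h6 : 175 * M * √(vl + 10 * e) ^ 3 ≤ 175 * M * (40 * (e * √e)) := by gcongr
    linarith

/-! ### Taylor expansion and the flip normal form. -/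

/-- Third order Taylor expansion with a quartic remainder near the base point. -/
lemma exists_cubic_taylor_bound {f : ℝ → ℝ} (hf : ContDiff ℝ 4 f) (x₀ : ℝ) :
    ∃ C ω : ℝ, 0 < C ∧ 0 < ω ∧ ω ≤ 1 ∧ ∀ w, |w| ≤ ω →
      |f (x₀ + w) - (f x₀ + deriv f x₀ * w + iteratedDeriv 2 f x₀ / 2 * w ^ 2 +
        iteratedDeriv 3 f x₀ / 6 * w ^ 3)| ≤ C * w ^ 4 := by
  have h := taylor_isLittleO_univ (x₀ := x₀) (n := 4) hf
  have h1 := h.bound one_pos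
  obtain ⟨ε, hε, hb⟩ := Metric.eventually_nhds_iff.1 h1
  -- The quartic Taylor term is absorbed into the constant; the 1 covers the little-o remainder.
  refine ⟨1 + |iteratedDeriv 4 f x₀ / 24|, min (ε / 2) 1, by positivity, by positivity,
    min_le_right _ _, fun w hw => ?_⟩
  have h2 := hb (y := x₀ + w) (by
    rw [Real.dist_eq, add_sub_cancel_left]
    linarith [min_le_left (ε / 2) 1])
  simp only [taylorWithinEval_succ, taylor_within_zero_eval, iteratedDerivWithin_univ,
    add_sub_cancel_left, Real.norm_eq_abs, smul_eq_mul, one_mul] at h2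
  norm_num [iteratedDeriv_one] at h2
  have h3 : |w| ^ 4 = w ^ 4 := by rw [← abs_pow]; exact abs_of_nonneg (by positivity)
  rw [h3] at h2
  have h4 : |iteratedDeriv 4 f x₀ / 24 * w ^ 4| = |iteratedDeriv 4 f x₀ / 24| * w ^ 4 := by
    rw [abs_mul, abs_of_nonneg (show 0 ≤ w ^ 4 by positivity)]
  rw [add_mul, ← h4, one_mul]
  refine le_trans ?_ (add_le_add_left h2 _)
  refine le_trans (le_of_eq ?_) (abs_add_le _ _)
  congr 1
  ring

lemma exists_bound_on_unit_box (P : ℝ → ℝ → ℝ) (hP : Continuous fun x : ℝ × ℝ => P x.1 x.2) :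
    ∃ C, 0 < C ∧ ∀ v w, |v| ≤ 1 → |w| ≤ 1 → |P v w| ≤ C := by
  obtain ⟨C, hC⟩ := ((isCompact_Icc (a := (-1 : ℝ)) (b := 1)).prod
    (isCompact_Icc (a := (-1 : ℝ)) (b := 1))).exists_bound_of_continuousOn hP.continuousOn
  refine ⟨|C| + 1, by positivity, fun v w hv hw => ?_⟩
  have := hC (v, w) ⟨abs_le.1 hv, abs_le.1 hw⟩
  simp only [Real.norm_eq_abs] at this
  linarith [le_abs_self C]

/-- The quadratic change of variables `q = w + β w² / 2` puts a map with multiplier near `-1` in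
the normal form `q ↦ -q (1 + v - (β² - γ) q²)`. -/
lemma flip_normal_form (β γ C : ℝ) (hC : 0 < C) :
    ∃ M, 0 < M ∧ ∀ w v w' e : ℝ, |w| ≤ 1 → |v| ≤ 1 → 0 ≤ e → e ≤ 1 →
      |w' - (-(1 + v) * w - (2 + v) * (β / 2 * w ^ 2 + γ / 2 * w ^ 3))| ≤
        C * (w ^ 4 + e * w ^ 2) →
      |(w' + β / 2 * w' ^ 2) + (w + β / 2 * w ^ 2) *
          (1 + v - (β ^ 2 - γ) * (w + β / 2 * w ^ 2) ^ 2)| ≤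
        M * (|v| * w ^ 2 + w ^ 4 + e * w ^ 2) := by
  obtain ⟨C₁, hC₁, h₁⟩ := exists_bound_on_unit_box
    (fun v w => β / 2 * (2 + v) + w * (-γ / 2 + β ^ 2 * (3 + v) / 2)) (by fun_prop)
  obtain ⟨C₂, hC₂, h₂⟩ := exists_bound_on_unit_box
    (fun v w => β / 2 * ((2 + v) ^ 2 * β ^ 2 / 4 + (1 + v) * (2 + v) * γ +
      (2 + v) ^ 2 * β * γ / 2 * w + (2 + v) ^ 2 * γ ^ 2 / 4 * w ^ 2) -
      (β ^ 2 - γ) * (3 * β / 2 + 3 * β ^ 2 / 4 * w + β ^ 3 / 8 * w ^ 2)) (by fun_prop)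
  obtain ⟨C₃, hC₃, h₃⟩ := exists_bound_on_unit_box
    (fun v w => 1 + β * (-(1 + v) * w - (2 + v) * (β / 2 * w ^ 2 + γ / 2 * w ^ 3)))
    (by fun_prop)
  refine ⟨C₁ + C₂ + C * (C₃ + |β / 2| * (C * 2)), by positivity, ?_⟩
  intro w v w' e hw hv he he1 hE
  specialize h₁ v w hv hw
  specialize h₂ v w hv hw
  specialize h₃ v w hv hw
  obtain ⟨E, hEdef⟩ : ∃ E, w' = (-(1 + v) * w - (2 + v) * (β / 2 * w ^ 2 + γ / 2 * w ^ 3)) + E :=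
    ⟨_, (add_sub_cancel _ _).symm⟩
  rw [hEdef, add_sub_cancel_left] at hE
  rw [hEdef]
  set P₁ := β / 2 * (2 + v) + w * (-γ / 2 + β ^ 2 * (3 + v) / 2) with hP₁
  set P₂ := β / 2 * ((2 + v) ^ 2 * β ^ 2 / 4 + (1 + v) * (2 + v) * γ +
      (2 + v) ^ 2 * β * γ / 2 * w + (2 + v) ^ 2 * γ ^ 2 / 4 * w ^ 2) -
      (β ^ 2 - γ) * (3 * β / 2 + 3 * β ^ 2 / 4 * w + β ^ 3 / 8 * w ^ 2) with hP₂
  set P₃ := 1 + β * (-(1 + v) * w - (2 + v) * (β / 2 * w ^ 2 + γ / 2 * w ^ 3)) with hP₃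
  have hw2 : w ^ 2 ≤ 1 := by rw [← sq_abs]; exact pow_le_one₀ (abs_nonneg _) hw
  have hw4 : w ^ 4 ≤ 1 := by
    rw [← Even.pow_abs (by decide)]; exact pow_le_one₀ (abs_nonneg _) hw
  have hE2 : |E| ≤ C * 2 := by
    refine hE.trans ?_
    have : e * w ^ 2 ≤ 1 := mul_le_one₀ he1 (sq_nonneg _) hw2
    gcongr
    linarith
  have key : ∀ A : ℝ, A + E + β / 2 * (A + E) ^ 2 = A + β / 2 * A ^ 2 +
    E * (1 + β * A + β / 2 * E) := fun A => by ring
  rw [key]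
  -- The choice of β/2 and β² − γ cancels every term of degree at most three in w except those
  -- divisible by v w².
  have hid : -(1 + v) * w - (2 + v) * (β / 2 * w ^ 2 + γ / 2 * w ^ 3) +
      β / 2 * (-(1 + v) * w - (2 + v) * (β / 2 * w ^ 2 + γ / 2 * w ^ 3)) ^ 2 +
      E * (P₃ + β / 2 * E) +
      (w + β / 2 * w ^ 2) * (1 + v - (β ^ 2 - γ) * (w + β / 2 * w ^ 2) ^ 2) =
      v * w ^ 2 * P₁ + w ^ 4 * P₂ + E * (P₃ + β / 2 * E) := by
    rw [hP₁, hP₂]; ring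
  rw [hid]
  have b1 : |v * w ^ 2 * P₁| ≤ |v| * w ^ 2 * C₁ := by
    rw [abs_mul, abs_mul, abs_of_nonneg (sq_nonneg w)]; gcongr
  have b2 : |w ^ 4 * P₂| ≤ w ^ 4 * C₂ := by
    rw [abs_mul, abs_of_nonneg (show 0 ≤ w ^ 4 by positivity)]; gcongr
  have b3 : |E * (P₃ + β / 2 * E)| ≤ C * (w ^ 4 + e * w ^ 2) * (C₃ + |β / 2| * (C * 2)) := by
    rw [abs_mul]
    gcongr
    refine (abs_add_le _ _).trans ?_
    rw [abs_mul]
    gcongr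
  have p1 : 0 ≤ |v| * w ^ 2 := by positivity
  have p2 : 0 ≤ w ^ 4 := by positivity
  have p3 : 0 ≤ e * w ^ 2 := by positivity
  set D := C * (C₃ + |β / 2| * (C * 2)) with hD
  have hD0 : 0 ≤ D := by positivity
  calc _ ≤ |v| * w ^ 2 * C₁ + w ^ 4 * C₂ + D * (w ^ 4 + e * w ^ 2) := by
        refine (abs_add_three _ _ _).trans ?_
        rw [hD]
        linarith
    _ ≤ _ := by
        have q1 := mul_nonneg hD0 p1
        have q2 := mul_nonneg hC₁.le p2
        have q3 := mul_nonneg hC₁.le p3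
        have q4 := mul_nonneg hC₂.le p1
        have q5 := mul_nonneg hC₂.le p3
        linarith

/-! ### Estimates for a single gradient step. -/

/-- One step of the parameter drift: if the squares satisfy the exact recursion
`T² - T'² = (T² - θ) (2 h - h²)` with `T = 2 + v`, then `T' = T - 2 h` to leading order. -/
lemma drift_step {v T' θ h : ℝ} (hv : |v| ≤ 1 / 2) (hT' : 0 ≤ T') (hθ : 0 ≤ θ) (hθ1 : θ ≤ 1)
    (hh : 0 ≤ h) (hh1 : h ≤ 1)
    (heq : (2 + v) ^ 2 - T' ^ 2 = ((2 + v) ^ 2 - θ) * (2 * h - h ^ 2)) :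
    |T' - (2 + v) + 2 * h| ≤ h * (5 * |v| + 17 * h + 2 * θ) := by
  obtain ⟨T, hT⟩ : ∃ T, T = 2 + v := ⟨_, rfl⟩
  obtain ⟨hv1, hv2⟩ := abs_le.1 hv
  have hv3 : v = T - 2 := by linarith
  rw [← hT] at heq ⊢
  have hT1 : 3 / 2 ≤ T := by linarith
  have hT2 : T ≤ 5 / 2 := by linarith
  have hs : 0 ≤ 2 * h - h ^ 2 := by nlinarith
  have hs2 : 2 * h - h ^ 2 ≤ 2 * h := by nlinarith
  have h1 : 0 ≤ T ^ 2 - θ := by nlinarith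
  have hle : T' ≤ T := by
    have := mul_nonneg h1 hs
    exact (sq_le_sq₀ hT' (by linarith)).1 (by linarith)
  have hdiff : T - T' ≤ 5 * h := by
    have h2 : (T - T') * T ≤ 2 * h * T * T := by
      have : (T ^ 2 - θ) * (2 * h - h ^ 2) ≤ T ^ 2 * (2 * h) := by gcongr; linarith
      nlinarith
    have h3 := le_of_mul_le_mul_right h2 (by linarith)
    nlinarith
  have hid : (T' - T + 2 * h) * (T + T') =
      -(h * (2 * T * v + 2 * (T - T') - θ * (2 - h) - h * T ^ 2)) := by
    rw [hv3]; linear_combination -heq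
  have hb : |2 * T * v + 2 * (T - T') - θ * (2 - h) - h * T ^ 2| ≤ 5 * |v| + 17 * h + 2 * θ := by
    have a1 : |2 * T * v| ≤ 5 * |v| := by
      rw [abs_mul, abs_of_nonneg (by linarith : 0 ≤ 2 * T)]; gcongr; linarith
    obtain ⟨a2, a3⟩ := abs_le.1 a1
    have a4 : 0 ≤ θ * (2 - h) := mul_nonneg hθ (by linarith)
    have a5 : θ * (2 - h) ≤ 2 * θ := by nlinarith
    have a6 : h * T ^ 2 ≤ h * 7 := by gcongr; nlinarith
    have a7 : 0 ≤ h * T ^ 2 := by positivity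
    exact abs_le.2 ⟨by linarith, by linarith⟩
  calc |T' - T + 2 * h| ≤ |T' - T + 2 * h| * (T + T') :=
        le_mul_of_one_le_right (abs_nonneg _) (by linarith)
    _ = h * |2 * T * v + 2 * (T - T') - θ * (2 - h) - h * T ^ 2| := by
        have : |T' - T + 2 * h| * (T + T') = |(T' - T + 2 * h) * (T + T')| := by
          rw [abs_mul, abs_of_nonneg (by linarith : 0 ≤ T + T')]
        rw [this, hid, abs_neg, abs_mul, abs_of_nonneg hh]
    _ ≤ _ := by gcongr

/-- The factor 1 + βw/2 lies between 1/2 and 3/2, so w and q are interchangeable in size. -/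
lemma norm_form_comparison {β w : ℝ} (hβ : |β| * |w| ≤ 1) :
    |w| ≤ 2 * |w + β / 2 * w ^ 2| ∧ |w + β / 2 * w ^ 2| ≤ 2 * |w| := by
  have h1 : w + β / 2 * w ^ 2 = w * (1 + β * w / 2) := by ring
  rw [← abs_mul] at hβ
  obtain ⟨h2, h3⟩ := abs_le.1 hβ
  rw [h1, abs_mul, abs_of_pos (by linarith : 0 < 1 + β * w / 2)]
  constructor <;> nlinarith [abs_nonneg w]

/-- The parameter `η a (x² + y²) - 2` differs little from its value after replacing `x y` by `z`. -/
lemma curvature_sub_drift {η a x y z : ℝ} (hη : 0 < η) (ha : 0 < a) (hw : |x * y - z| ≤ 1)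
    (hS : 1 ≤ η * a * √((x ^ 2 - y ^ 2) ^ 2 + 4 * z ^ 2)) :
    |η * a * (x ^ 2 + y ^ 2) - η * a * √((x ^ 2 - y ^ 2) ^ 2 + 4 * z ^ 2)| ≤
      4 * (2 * |z| + 1) * a ^ 2 * η ^ 2 * |x * y - z| := by
  set S := √((x ^ 2 - y ^ 2) ^ 2 + 4 * z ^ 2) with hSdef
  have hS2 : S ^ 2 = (x ^ 2 - y ^ 2) ^ 2 + 4 * z ^ 2 := Real.sq_sqrt (by positivity)
  have hS0 : 0 ≤ S := Real.sqrt_nonneg _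
  set w := x * y - z with hwdef
  -- `S` is x² + y² with xy replaced by z, so the squares differ by 4((xy)² − z²).
  have hid : (x ^ 2 + y ^ 2 - S) * (x ^ 2 + y ^ 2 + S) = 4 * w * (2 * z + w) := by
    rw [hwdef]; linear_combination -hS2
  have h1 : |2 * z + w| ≤ 2 * |z| + 1 := by
    refine (abs_add_le _ _).trans ?_
    rw [abs_mul, abs_two]
    linarith
  have hs : 0 ≤ x ^ 2 + y ^ 2 + S := by positivity
  have hηa : 0 < η * a := by positivity
  rw [← mul_sub, abs_mul, abs_of_pos hηa]
  have h2 : 1 ≤ η * a * (x ^ 2 + y ^ 2 + S) := by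
    have : 0 ≤ η * a * (x ^ 2 + y ^ 2) := by positivity
    linarith
  calc η * a * |x ^ 2 + y ^ 2 - S|
      ≤ η * a * |x ^ 2 + y ^ 2 - S| * (η * a * (x ^ 2 + y ^ 2 + S)) :=
        le_mul_of_one_le_right (by positivity) h2
    _ = (η * a) ^ 2 * |(x ^ 2 + y ^ 2 - S) * (x ^ 2 + y ^ 2 + S)| := by
        rw [abs_mul, abs_of_nonneg hs]; ring
    _ = (η * a) ^ 2 * (4 * |w| * |2 * z + w|) := by
        rw [hid, abs_mul, abs_mul]; norm_num
    _ ≤ (η * a) ^ 2 * (4 * |w| * (2 * |z| + 1)) := by gcongr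
    _ = _ := by ring

/-- Bounds on a function with a prescribed third order expansion. -/
lemma expansion_bounds {g a b c C w : ℝ} (ha : 0 < a) (hC : 0 < C) (hw : |w| ≤ 1)
    (hg : |g - (a * w + b / 2 * w ^ 2 + c / 6 * w ^ 3)| ≤ C * w ^ 4) :
    |g| ≤ (a + |b| + |c| + C) * |w| ∧
      |g ^ 2 - a ^ 2 * (w + b / a / 2 * w ^ 2) ^ 2| ≤
        (|c| + C) * (2 * (a + |b| + |c| + C)) * w ^ 4 := by
  have hw0 := abs_nonneg w
  have e2 : w ^ 2 = |w| ^ 2 := (sq_abs w).symm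
  have e4 : w ^ 4 = |w| ^ 4 := (Even.pow_abs (by decide) w).symm
  have hp2 : |w| ^ 2 ≤ |w| := by nlinarith
  have hp3 : |w| ^ 3 ≤ |w| := by nlinarith [mul_nonneg hw0 hw0]
  have hp43 : |w| ^ 4 ≤ |w| ^ 3 := by
    have : |w| ^ 4 = |w| ^ 3 * |w| := by ring
    rw [this]; exact mul_le_of_le_one_right (by positivity) hw
  have hb0 := abs_nonneg b
  have hc0 := abs_nonneg c
  have haq : a * (w + b / a / 2 * w ^ 2) = a * w + b / 2 * w ^ 2 := by field_simp
  have t1 : |c / 6 * w ^ 3| ≤ |c| * |w| ^ 3 := by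
    rw [abs_mul, abs_pow, abs_div]
    gcongr
    exact div_le_self hc0 (by norm_num)
  have t2 : |b / 2 * w ^ 2| ≤ |b| * |w| ^ 2 := by
    rw [abs_mul, abs_pow, abs_div]
    gcongr
    exact div_le_self hb0 (by norm_num)
  have t3 : |a * w| = a * |w| := by rw [abs_mul, abs_of_pos ha]
  rw [e4] at hg
  have hgq : |g - a * (w + b / a / 2 * w ^ 2)| ≤ (|c| + C) * |w| ^ 3 := by
    rw [haq]
    have : g - (a * w + b / 2 * w ^ 2) =
      (g - (a * w + b / 2 * w ^ 2 + c / 6 * w ^ 3)) + c / 6 * w ^ 3 := by ring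
    rw [this]
    refine (abs_add_le _ _).trans ?_
    nlinarith
  have haqb : |a * (w + b / a / 2 * w ^ 2)| ≤ (a + |b|) * |w| := by
    rw [haq]
    refine (abs_add_le _ _).trans ?_
    nlinarith
  have hgb : |g| ≤ (a + |b| + |c| + C) * |w| := by
    have : g = (g - a * (w + b / a / 2 * w ^ 2)) + a * (w + b / a / 2 * w ^ 2) := by ring
    rw [this]
    refine (abs_add_le _ _).trans ?_
    nlinarith
  refine ⟨hgb, ?_⟩
  have : g ^ 2 - a ^ 2 * (w + b / a / 2 * w ^ 2) ^ 2 =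
    (g - a * (w + b / a / 2 * w ^ 2)) * (g + a * (w + b / a / 2 * w ^ 2)) := by ring
  rw [this, abs_mul]
  calc _ ≤ (|c| + C) * |w| ^ 3 * (2 * (a + |b| + |c| + C) * |w|) := by
        gcongr
        refine (abs_add_le _ _).trans ?_
        nlinarith
    _ = _ := by rw [e4]; ring

/-- The residual `w = x y - z` after a gradient step, to leading order. -/
lemma residual_step {η a b c C G x y z g w v : ℝ} (hη : 0 < η) (ha : 0 < a) (hC : 0 < C)
    (hwdef : w = x * y - z) (hw : |w| ≤ 1) (hG : 0 < G) (hgG : |g| ≤ G * |w|)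
    (hg : |g - (a * w + b / 2 * w ^ 2 + c / 6 * w ^ 3)| ≤ C * w ^ 4) (hv : |v| ≤ 1)
    (hvdef : 2 + v = η * a * √((x ^ 2 - y ^ 2) ^ 2 + 4 * z ^ 2)) :
    |((x - η * g * y) * (y - η * g * x) - z) - (-(1 + v) * w -
        (2 + v) * (b / a / 2 * w ^ 2 + c / (3 * a) / 2 * w ^ 3))| ≤
      (4 * (2 * |z| + 1) * a * G + G ^ 2 * (|z| + 1) + 3 * C / a) *
        (w ^ 4 + η ^ 2 * w ^ 2) := by
  have hud := curvature_sub_drift hη ha (by rwa [← hwdef]) (by linarith [(abs_le.1 hv).1])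
  rw [← hvdef, ← hwdef] at hud
  have hxy : x * y = w + z := by linarith
  set u := η * a * (x ^ 2 + y ^ 2) with hu
  -- Three error sources: replacing ηa(x² + y²) by 2 + v, the term quadratic in η, and the Taylor
  -- remainder.
  have hid : ((x - η * g * y) * (y - η * g * x) - z) - (-(1 + v) * w -
        (2 + v) * (b / a / 2 * w ^ 2 + c / (3 * a) / 2 * w ^ 3)) =
      -((u - (2 + v)) * (g / a)) + η ^ 2 * g ^ 2 * (w + z) -
      (2 + v) / a * (g - (a * w + b / 2 * w ^ 2 + c / 6 * w ^ 3)) := by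
    have h1 : (x - η * g * y) * (y - η * g * x) - z =
        w - u * (g / a) + η ^ 2 * g ^ 2 * (w + z) := by
      rw [hu, ← hxy, hwdef]
      field_simp
      ring
    rw [h1]
    field_simp
    ring
  rw [hid]
  have hw0 := abs_nonneg w
  have e2 : w ^ 2 = |w| ^ 2 := (sq_abs w).symm
  have b1 : |(u - (2 + v)) * (g / a)| ≤ 4 * (2 * |z| + 1) * a * G * (η ^ 2 * w ^ 2) := by
    rw [abs_mul, abs_div, abs_of_pos ha]
    calc _ ≤ (4 * (2 * |z| + 1) * a ^ 2 * η ^ 2 * |w|) * (G * |w| / a) := by gcongr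
      _ = _ := by rw [e2]; field_simp
  have b2 : |η ^ 2 * g ^ 2 * (w + z)| ≤ G ^ 2 * (|z| + 1) * (η ^ 2 * w ^ 2) := by
    rw [abs_mul, abs_mul, abs_of_nonneg (sq_nonneg η), abs_pow]
    calc _ ≤ η ^ 2 * (G * |w|) ^ 2 * (|z| + 1) := by
          gcongr
          exact (abs_add_le _ _).trans (by linarith)
      _ = _ := by rw [e2]; ring
  have b3 : |(2 + v) / a * (g - (a * w + b / 2 * w ^ 2 + c / 6 * w ^ 3))| ≤
      3 * C / a * w ^ 4 := by
    rw [abs_mul, abs_div, abs_of_pos ha]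
    calc _ ≤ 3 / a * (C * w ^ 4) := by
          gcongr
          exact abs_le.2 ⟨by linarith [(abs_le.1 hv).1], by linarith [(abs_le.1 hv).2]⟩
      _ = _ := by ring
  have p1 : 0 ≤ w ^ 4 := by positivity
  have p2 : 0 ≤ η ^ 2 * w ^ 2 := by positivity
  have c1 : 0 ≤ 4 * (2 * |z| + 1) * a * G := by positivity
  have c2 : 0 ≤ G ^ 2 * (|z| + 1) := by positivity
  have c3 : 0 ≤ 3 * C / a := by positivity
  have q1 := mul_nonneg c1 p1
  have q2 := mul_nonneg c2 p1
  have q3 := mul_nonneg c3 p2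
  refine (abs_sub _ _).trans ?_
  have := abs_add_le (-((u - (2 + v)) * (g / a))) (η ^ 2 * g ^ 2 * (w + z))
  rw [abs_neg] at this
  linarith

/-- The drift of `v = η a √((x² - y²)² + 4 z²) - 2` in a gradient step, to leading order. -/
lemma drift_gradient_step {η a G G₁ q x y z g w v : ℝ} (hη : 0 < η) (ha : 0 < a)
    (hG : |g| ≤ G * |w|) (hG0 : 0 < G) (hw : |w| ≤ 1) (hηG : η * G ≤ 1)
    (hηz : η * (2 * a * |z|) ≤ 1) (hgq : |g ^ 2 - a ^ 2 * q ^ 2| ≤ G₁ * w ^ 4)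
    (hv : |v| ≤ 1 / 2) (hvdef : 2 + v = η * a * √((x ^ 2 - y ^ 2) ^ 2 + 4 * z ^ 2)) :
    |η * a * √(((x - η * g * y) ^ 2 - (y - η * g * x) ^ 2) ^ 2 + 4 * z ^ 2) - (2 + v) +
        2 * (a ^ 2 * η ^ 2 * q ^ 2)| ≤
      η ^ 2 * G ^ 2 * w ^ 2 * (5 * |v| + 17 * (η ^ 2 * G ^ 2 * w ^ 2) +
        8 * (η ^ 2 * a ^ 2 * z ^ 2)) + 2 * η ^ 2 * G₁ * w ^ 4 := by
  have e2 : w ^ 2 = |w| ^ 2 := (sq_abs w).symm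
  have hg2 : g ^ 2 ≤ G ^ 2 * w ^ 2 := by
    rw [← sq_abs g, e2, ← mul_pow]; gcongr
  have hh : η ^ 2 * g ^ 2 ≤ η ^ 2 * G ^ 2 * w ^ 2 := by
    rw [mul_assoc]; gcongr
  have hw2 : w ^ 2 ≤ 1 := by rw [e2]; exact pow_le_one₀ (abs_nonneg _) hw
  have hh1 : η ^ 2 * g ^ 2 ≤ 1 := by
    refine hh.trans ?_
    rw [← mul_pow]
    exact mul_le_one₀ (pow_le_one₀ (by positivity) hηG) (sq_nonneg _) hw2
  have hθ1 : 4 * (η ^ 2 * a ^ 2 * z ^ 2) ≤ 1 := by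
    have : 4 * (η ^ 2 * a ^ 2 * z ^ 2) = (η * (2 * a * |z|)) ^ 2 := by
      rw [mul_pow, mul_pow, sq_abs]; ring
    rw [this]
    exact pow_le_one₀ (by positivity) hηz
  set T' := η * a * √(((x - η * g * y) ^ 2 - (y - η * g * x) ^ 2) ^ 2 + 4 * z ^ 2) with hT'
  -- Since x² − y² is multiplied by 1 − h with h = η²g², the excess of the squared parameter over θ
  -- = 4η²a²z² is multiplied by (1 − h)².
  have hd := drift_step (T' := T') (θ := 4 * (η ^ 2 * a ^ 2 * z ^ 2)) (h := η ^ 2 * g ^ 2) hv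
    (by positivity) (by positivity) hθ1 (by positivity) hh1 (by
      rw [hT', hvdef, mul_pow, mul_pow _ (√_), Real.sq_sqrt (by positivity),
        Real.sq_sqrt (by positivity)]
      ring)
  have hsplit : T' - (2 + v) + 2 * (a ^ 2 * η ^ 2 * q ^ 2) =
      (T' - (2 + v) + 2 * (η ^ 2 * g ^ 2)) - 2 * η ^ 2 * (g ^ 2 - a ^ 2 * q ^ 2) := by ring
  rw [hsplit]
  refine (abs_sub _ _).trans ?_
  have h1 : |2 * η ^ 2 * (g ^ 2 - a ^ 2 * q ^ 2)| ≤ 2 * η ^ 2 * G₁ * w ^ 4 := by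
    rw [abs_mul, abs_of_nonneg (by positivity : 0 ≤ 2 * η ^ 2), mul_assoc _ G₁]
    gcongr
  have h2 : η ^ 2 * g ^ 2 * (5 * |v| + 17 * (η ^ 2 * g ^ 2) + 2 * (4 * (η ^ 2 * a ^ 2 * z ^ 2))) ≤
      η ^ 2 * G ^ 2 * w ^ 2 * (5 * |v| + 17 * (η ^ 2 * G ^ 2 * w ^ 2) +
        8 * (η ^ 2 * a ^ 2 * z ^ 2)) := by
    gcongr ?_ * ?_
    linarith
  linarith

/-! ### Amplitude and drift coordinates: reduction to the model. -/

/-- The amplitude of the residual `w` in normal form coordinates, scaled so that the slow curve is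
`r² = v + e`. -/
noncomputable def flipAmplitude (K β w : ℝ) : ℝ := √K * |w + β / 2 * w ^ 2|

/-- The excess over `2` of `η` times the sharpness at the minimizer with the same value of
`x² - y²`. -/
noncomputable def driftParam (η a z x y : ℝ) : ℝ :=
  η * a * √((x ^ 2 - y ^ 2) ^ 2 + 4 * z ^ 2) - 2

lemma flipAmplitude_sq {K : ℝ} (hK : 0 ≤ K) (β w : ℝ) :
    flipAmplitude K β w ^ 2 = K * (w + β / 2 * w ^ 2) ^ 2 := by
  rw [flipAmplitude, mul_pow, Real.sq_sqrt hK, sq_abs]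

lemma abs_le_flipAmplitude {K β w : ℝ} (hK : 0 < K) (hβ : |β| * |w| ≤ 1) :
    |w| ≤ 2 / √K * flipAmplitude K β w := by
  have h0 := Real.sqrt_pos.2 hK
  have : 2 / √K * flipAmplitude K β w = 2 * |w + β / 2 * w ^ 2| := by
    rw [flipAmplitude]; field_simp
  rw [this]
  exact (norm_form_comparison hβ).1

lemma sq_le_flipAmplitude_sq {K β w : ℝ} (hK : 0 < K) (hβ : |β| * |w| ≤ 1) :
    w ^ 2 ≤ 4 / K * flipAmplitude K β w ^ 2 := by
  have h1 := abs_le_flipAmplitude hK hβ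
  rw [← sq_abs]
  calc |w| ^ 2 ≤ (2 / √K * flipAmplitude K β w) ^ 2 := by gcongr
    _ = _ := by rw [mul_pow, div_pow, Real.sq_sqrt hK.le]; norm_num

set_option maxHeartbeats 1000000 in
/-- In the coordinates `flipAmplitude`, `driftParam` a gradient step is a step of the slow passage
through a flip bifurcation. -/
lemma exists_gradient_slowStep {g : ℝ → ℝ} {z a b c C ω₀ : ℝ} (ha : 0 < a) (hC : 0 < C)
    (hω₀ : 0 < ω₀) (hω₁ : ω₀ ≤ 1) (hK : 0 < (b / a) ^ 2 - c / (3 * a))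
    (hg : ∀ w, |w| ≤ ω₀ →
      |g (z + w) - (a * w + b / 2 * w ^ 2 + c / 6 * w ^ 3)| ≤ C * w ^ 4) :
    ∃ M ρ ω η₀ : ℝ, 1 ≤ M ∧ 0 < ρ ∧ ρ ≤ 1 / 2 ∧ 0 < ω ∧ ω ≤ ω₀ ∧ |b / a| * ω ≤ 1 ∧ 0 < η₀ ∧
      ∀ η, 0 < η → η ≤ η₀ → ∀ x y x' y', x' = x - η * g (x * y) * y →
        y' = y - η * g (x * y) * x → |x * y - z| ≤ ω →
        flipAmplitude ((b / a) ^ 2 - c / (3 * a)) (b / a) (x * y - z) ≤ ρ →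
        |driftParam η a z x y| ≤ ρ →
        |x' * y' - z| ≤ ω ∧
        SlowStep M (a ^ 2 * η ^ 2 / ((b / a) ^ 2 - c / (3 * a)))
          (flipAmplitude ((b / a) ^ 2 - c / (3 * a)) (b / a) (x * y - z))
          (driftParam η a z x y)
          (flipAmplitude ((b / a) ^ 2 - c / (3 * a)) (b / a) (x' * y' - z))
          (driftParam η a z x' y') := by
  set β := b / a with hβ
  set γ := c / (3 * a) with hγ
  set K := β ^ 2 - γ with hKdef
  have hsK := Real.sqrt_pos.2 hK
  obtain ⟨G, hGdef⟩ : ∃ G, G = a + |b| + |c| + C := ⟨_, rfl⟩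
  have hG : 0 < G := by rw [hGdef]; positivity
  obtain ⟨G₁, hG₁def⟩ : ∃ G₁, G₁ = (|c| + C) * (2 * G) := ⟨_, rfl⟩
  have hG₁ : 0 < G₁ := by rw [hG₁def]; positivity
  obtain ⟨C₁, hC₁def⟩ : ∃ C₁, C₁ = 4 * (2 * |z| + 1) * a * G + G ^ 2 * (|z| + 1) + 3 * C / a :=
    ⟨_, rfl⟩
  have hC₁ : 0 < C₁ := by rw [hC₁def]; positivity
  obtain ⟨M₁, hM₁, hnf⟩ := flip_normal_form β γ C₁ hC₁
  obtain ⟨M₂, hM₂def⟩ : ∃ M₂, M₂ = 2 + 3 * (|β / 2| + |γ / 2|) + 2 * C₁ := ⟨_, rfl⟩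
  have hM₂ : 0 < M₂ := by rw [hM₂def]; positivity
  obtain ⟨H, hHdef⟩ : ∃ H, H = 4 * G ^ 2 / a ^ 2 := ⟨_, rfl⟩
  have hH : 0 < H := by rw [hHdef]; positivity
  obtain ⟨A, hAdef⟩ : ∃ A, A = √K * M₁ * (4 / K + 16 / K ^ 2 + 4 / a ^ 2) := ⟨_, rfl⟩
  have hA : 0 < A := by rw [hAdef]; positivity
  obtain ⟨B, hBdef⟩ : ∃ B, B = H * (5 + 17 * H + 8 * K * z ^ 2) + 32 * G₁ / (a ^ 2 * K) :=
    ⟨_, rfl⟩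
  have hB : 0 < B := by rw [hBdef]; positivity
  obtain ⟨ω, hω, hω', hβω⟩ : ∃ ω, 0 < ω ∧ ω ≤ ω₀ ∧ |β| * ω ≤ 1 := by
    refine ⟨min ω₀ (1 / (|β| + 1)), by positivity, min_le_left _ _, ?_⟩
    calc |β| * min ω₀ (1 / (|β| + 1)) ≤ |β| * (1 / (|β| + 1)) := by
          gcongr; exact min_le_right _ _
      _ ≤ 1 := by rw [mul_one_div, div_le_one (by positivity)]; linarith
  obtain ⟨η₀, hη₀, hη₁, hηG, hηz⟩ : ∃ η₀, 0 < η₀ ∧ η₀ ≤ 1 ∧ η₀ * G ≤ 1 ∧ η₀ * (2 * a * |z|) ≤ 1 := by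
    have hpos : 0 < 1 + G + 2 * a * |z| := by positivity
    have hz : 0 ≤ 2 * a * |z| := by positivity
    refine ⟨1 / (1 + G + 2 * a * |z|), by positivity, ?_, ?_, ?_⟩
    · rw [div_le_one hpos]; linarith
    · rw [one_div_mul_eq_div, div_le_one hpos]; linarith
    · rw [one_div_mul_eq_div, div_le_one hpos]; linarith
  -- The second entry of the minimum makes r ≤ ρ imply |w'| ≤ M₂|w| ≤ ω, so the condition on w
  -- reproduces itself. `A` bounds the fast error, `B` the slow one.
  refine ⟨1 + A + B, min (1 / 2) (ω * √K / (2 * M₂)), ω, η₀, by linarith, by positivity,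
    min_le_left _ _, hω, hω', hβω, hη₀, ?_⟩
  intro η hη hηη x y x' y' hx' hy' hw hr hv
  obtain ⟨w, hwdef⟩ : ∃ w, w = x * y - z := ⟨_, rfl⟩
  obtain ⟨w', hw'def⟩ : ∃ w', w' = x' * y' - z := ⟨_, rfl⟩
  have hxy : x * y = z + w := by linarith
  have hg := hg w (by rw [hwdef]; linarith)
  rw [← hxy] at hg
  set g₀ := g (x * y) with hg₀
  rw [← hwdef] at hw hr ⊢
  rw [← hw'def]
  obtain ⟨v, hvdef⟩ : ∃ v, v = driftParam η a z x y := ⟨_, rfl⟩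
  obtain ⟨v', hv'def⟩ : ∃ v', v' = driftParam η a z x' y' := ⟨_, rfl⟩
  obtain ⟨r, hrdef⟩ : ∃ r, r = flipAmplitude K β w := ⟨_, rfl⟩
  rw [← hvdef] at hv ⊢
  rw [← hv'def, ← hrdef]
  rw [← hrdef] at hr
  have hw1 : |w| ≤ 1 := by linarith
  have hv2 : |v| ≤ 1 / 2 := hv.trans (min_le_left _ _)
  have hr2 : r ≤ 1 / 2 := hr.trans (min_le_left _ _)
  have hβw : |β| * |w| ≤ 1 := le_trans (by gcongr) hβω
  have hr0 : 0 ≤ r := by rw [hrdef, flipAmplitude]; positivity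
  have hrsq := flipAmplitude_sq hK.le β w
  have hwr := abs_le_flipAmplitude hK hβw
  have hwr2 := sq_le_flipAmplitude_sq hK hβw
  rw [← hrdef] at hrsq hwr hwr2
  have hwr4 : w ^ 4 ≤ 16 / K ^ 2 * r ^ 4 := by
    calc w ^ 4 = (w ^ 2) ^ 2 := by ring
      _ ≤ (4 / K * r ^ 2) ^ 2 := by gcongr
      _ = _ := by rw [mul_pow, div_pow]; ring
  obtain ⟨hgb, hgq⟩ := expansion_bounds ha hC hw1 hg
  rw [← hGdef] at hgb hgq
  rw [← hG₁def] at hgq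
  have hvS : 2 + v = η * a * √((x ^ 2 - y ^ 2) ^ 2 + 4 * z ^ 2) := by
    rw [hvdef, driftParam, add_sub_cancel]
  have hres := residual_step hη ha hC hwdef hw1 hG hgb hg (by linarith) hvS
  rw [← hx', ← hy', ← hw'def, ← hC₁def, ← hγ, ← hβ] at hres
  have hη2 : η ^ 2 ≤ 1 := pow_le_one₀ hη.le (by linarith)
  obtain ⟨e, hedef⟩ : ∃ e, e = a ^ 2 * η ^ 2 / K := ⟨_, rfl⟩
  have he : 0 < e := by rw [hedef]; positivity
  have hηe : η ^ 2 = K * e / a ^ 2 := by rw [hedef]; field_simp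
  rw [← hedef]
  have hw0 := abs_nonneg w
  have hv0 := abs_nonneg v
  have hsq : w ^ 2 = |w| ^ 2 := (sq_abs w).symm
  refine ⟨?_, ⟨?_, ?_⟩⟩
  · have h1 : |w'| ≤ M₂ * |w| := by
      have h2 : |w| ^ 2 ≤ |w| := by rw [sq]; exact mul_le_of_le_one_left hw0 hw1
      have h3 : |w| ^ 3 ≤ |w| := by
        have : |w| ^ 3 = |w| ^ 2 * |w| := by ring
        rw [this]; exact mul_le_of_le_one_left hw0 (h2.trans hw1)
      have h4 : w ^ 4 + η ^ 2 * w ^ 2 ≤ 2 * |w| := by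
        have h5 : w ^ 4 ≤ w ^ 2 := by
          have : w ^ 4 = w ^ 2 * w ^ 2 := by ring
          rw [this]; exact mul_le_of_le_one_left (sq_nonneg _) (by linarith)
        have h6 : η ^ 2 * w ^ 2 ≤ w ^ 2 := mul_le_of_le_one_left (sq_nonneg _) hη2
        linarith
      have h7 : |-(1 + v) * w - (2 + v) * (β / 2 * w ^ 2 + γ / 2 * w ^ 3)| ≤
          2 * |w| + 3 * (|β / 2| * |w| + |γ / 2| * |w|) := by
        refine (abs_sub _ _).trans ?_
        rw [abs_mul, abs_mul, abs_neg]
        have h8 : |1 + v| ≤ 2 := (abs_add_le _ _).trans (by rw [abs_one]; linarith)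
        have h9 : |2 + v| ≤ 3 := (abs_add_le _ _).trans (by rw [abs_two]; linarith)
        gcongr
        refine (abs_add_le _ _).trans ?_
        rw [abs_mul, abs_mul, abs_pow, abs_pow]
        gcongr
      have h8 : w' = (w' - (-(1 + v) * w - (2 + v) * (β / 2 * w ^ 2 + γ / 2 * w ^ 3))) +
        (-(1 + v) * w - (2 + v) * (β / 2 * w ^ 2 + γ / 2 * w ^ 3)) := by ring
      have h9 := mul_le_mul_of_nonneg_left h4 hC₁.le
      rw [h8]
      refine (abs_add_le _ _).trans ?_
      rw [hM₂def]
      linarith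
    calc |w'| ≤ M₂ * |w| := h1
      _ ≤ M₂ * (2 / √K * (ω * √K / (2 * M₂))) := by
          gcongr
          refine hwr.trans ?_
          gcongr
          exact hr.trans (min_le_right _ _)
      _ = ω := by field_simp
  · have hn := hnf w v w' (η ^ 2) hw1 (by linarith) (by positivity) hη2 hres
    rw [← hKdef] at hn
    set q := w + β / 2 * w ^ 2 with hq
    set q' := w' + β / 2 * w' ^ 2 with hq'
    have hpos : 0 ≤ 1 + v - r ^ 2 := by
      have : r ^ 2 ≤ 1 / 2 * (1 / 2) := by rw [sq]; gcongr
      linarith [(abs_le.1 hv2).1]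
    -- Absolute values remove the flip: a multiplier near −1 for q becomes one near 1 for r.
    have hid : flipAmplitude K β w' - r * (1 + v - r ^ 2) =
        √K * (|q'| - |-(q * (1 + v - K * q ^ 2))|) := by
      rw [abs_neg, abs_mul, ← hrsq, abs_of_nonneg hpos, hrdef, flipAmplitude, flipAmplitude, ← hq,
        ← hq']
      ring
    rw [hid, abs_mul, abs_of_pos hsK]
    have h1 : |(|q'| - |-(q * (1 + v - K * q ^ 2))|)| ≤ |q' + q * (1 + v - K * q ^ 2)| := by
      refine (abs_abs_sub_abs_le _ _).trans ?_
      rw [sub_neg_eq_add]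
    have h2 : |v| * w ^ 2 + w ^ 4 + η ^ 2 * w ^ 2 ≤
        (4 / K + 16 / K ^ 2 + 4 / a ^ 2) * (r ^ 2 * (|v| + r ^ 2 + e)) := by
      have h3 : |v| * w ^ 2 ≤ |v| * (4 / K * r ^ 2) := by gcongr
      have h4 : η ^ 2 * w ^ 2 ≤ K * e / a ^ 2 * (4 / K * r ^ 2) := by rw [hηe]; gcongr
      have h5 : K * e / a ^ 2 * (4 / K * r ^ 2) = 4 / a ^ 2 * (r ^ 2 * e) := by field_simp
      have e1 : 0 ≤ 4 / K * (r ^ 2 * r ^ 2) := by positivity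
      have e2 : 0 ≤ 4 / K * (r ^ 2 * e) := by positivity
      have e3 : 0 ≤ 16 / K ^ 2 * (r ^ 2 * |v|) := by positivity
      have e4 : 0 ≤ 16 / K ^ 2 * (r ^ 2 * e) := by positivity
      have e5 : 0 ≤ 4 / a ^ 2 * (r ^ 2 * |v|) := by positivity
      have e6 : 0 ≤ 4 / a ^ 2 * (r ^ 2 * r ^ 2) := by positivity
      linarith
    have hN : 0 ≤ r ^ 2 * (|v| + r ^ 2 + e) := by positivity
    calc _ ≤ √K * (M₁ * ((4 / K + 16 / K ^ 2 + 4 / a ^ 2) * (r ^ 2 * (|v| + r ^ 2 + e)))) := by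
          gcongr
          exact (h1.trans hn).trans (by gcongr)
      _ = A * (r ^ 2 * (|v| + r ^ 2 + e)) := by rw [hAdef]; ring
      _ ≤ (1 + A + B) * (r ^ 2 * (|v| + r ^ 2 + e)) := by gcongr; linarith
      _ = _ := by ring
  · have hηG' : η * G ≤ 1 := le_trans (by gcongr) hηG
    have hηz' : η * (2 * a * |z|) ≤ 1 := le_trans (by gcongr) hηz
    have hd := drift_gradient_step hη ha hgb hG hw1 hηG' hηz' hgq hv2 hvS
    rw [← hx', ← hy', ← hβ] at hd
    have hid : v' - (v - 2 * e * r ^ 2) =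
        η * a * √((x' ^ 2 - y' ^ 2) ^ 2 + 4 * z ^ 2) - (2 + v) +
          2 * (a ^ 2 * η ^ 2 * (w + β / 2 * w ^ 2) ^ 2) := by
      rw [hv'def, driftParam, hrsq, hedef]
      field_simp
      ring
    rw [hid]
    refine hd.trans ?_
    have hh : η ^ 2 * G ^ 2 * w ^ 2 ≤ H * (e * r ^ 2) := by
      calc η ^ 2 * G ^ 2 * w ^ 2 ≤ η ^ 2 * G ^ 2 * (4 / K * r ^ 2) := by gcongr
        _ = _ := by rw [hHdef, hηe]; field_simp
    have hr21 : r ^ 2 ≤ 1 := pow_le_one₀ hr0 (by linarith)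
    have hhe : η ^ 2 * G ^ 2 * w ^ 2 ≤ H * e := by
      refine hh.trans ?_
      gcongr
      exact mul_le_of_le_one_right he.le hr21
    have hr43 : r ^ 4 ≤ r ^ 2 * r := by
      have : r ^ 4 = r ^ 2 * r * r := by ring
      rw [this]; exact mul_le_of_le_one_right (by positivity) (by linarith)
    have h1 : 2 * η ^ 2 * G₁ * w ^ 4 ≤ 32 * G₁ / (a ^ 2 * K) * (e * r ^ 2 * r) := by
      calc 2 * η ^ 2 * G₁ * w ^ 4 ≤ 2 * η ^ 2 * G₁ * (16 / K ^ 2 * (r ^ 2 * r)) := by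
            gcongr
            exact hwr4.trans (by gcongr)
        _ = _ := by rw [hηe]; field_simp; ring
    have h2 : 8 * (η ^ 2 * a ^ 2 * z ^ 2) = 8 * K * z ^ 2 * e := by
      rw [hηe]; field_simp
    have h3 : η ^ 2 * G ^ 2 * w ^ 2 * (5 * |v| + 17 * (η ^ 2 * G ^ 2 * w ^ 2) +
        8 * (η ^ 2 * a ^ 2 * z ^ 2)) ≤
        H * (e * r ^ 2) * (5 * |v| + 17 * (H * e) + 8 * K * z ^ 2 * e) := by
      rw [h2]
      gcongr
    have h4 : 5 * |v| + 17 * (H * e) + 8 * K * z ^ 2 * e ≤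
        (5 + 17 * H + 8 * K * z ^ 2) * (r + |v| + e) := by
      have e0 : 0 ≤ (5 + 17 * H + 8 * K * z ^ 2) * r := by positivity
      have e1 : 0 ≤ 17 * H * |v| := by positivity
      have e2 : 0 ≤ 8 * K * z ^ 2 * |v| := by positivity
      linarith
    calc _ ≤ H * (e * r ^ 2) * ((5 + 17 * H + 8 * K * z ^ 2) * (r + |v| + e)) +
          32 * G₁ / (a ^ 2 * K) * (e * r ^ 2 * (r + |v| + e)) := by
          refine add_le_add (h3.trans (by gcongr)) (h1.trans ?_)
          gcongr
          linarith
      _ = B * (e * r ^ 2 * (r + |v| + e)) := by rw [hBdef]; ring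
      _ ≤ (1 + A + B) * (e * r ^ 2 * (r + |v| + e)) := by gcongr; linarith
      _ = _ := by ring

/-! ### Gradient, Hessian and sharpness of the product loss. -/

lemma hasGradientAt_productLoss {l : ℝ → ℝ} (p : EuclideanSpace ℝ (Fin 2))
    (hl : DifferentiableAt ℝ l (p 0 * p 1)) :
    HasGradientAt (productLoss l) (deriv l (p 0 * p 1) • !₂[p 1, p 0]) p := by
  rw [hasGradientAt_iff_hasFDerivAt]
  have h0 := (EuclideanSpace.proj (𝕜 := ℝ) (0 : Fin 2)).hasFDerivAt (x := p)
  have h1 := (EuclideanSpace.proj (𝕜 := ℝ) (1 : Fin 2)).hasFDerivAt (x := p)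
  have h := hl.hasDerivAt.comp_hasFDerivAt p (h0.mul h1)
  refine h.congr_fderiv ?_
  ext h
  simp [PiLp.inner_apply, Fin.sum_univ_two]
  ring

lemma gradient_productLoss {l : ℝ → ℝ} (hl : Differentiable ℝ l) :
    gradient (productLoss l) = fun p => deriv l (p 0 * p 1) • !₂[p 1, p 0] :=
  funext fun p => (hasGradientAt_productLoss p (hl _)).gradient

/-- Where l' vanishes only a rank-one part survives: l'' times the outer product of (y, x) with
itself. -/
lemma hessian_productLoss_apply {l : ℝ → ℝ} (hl : ContDiff ℝ 2 l)
    {p : EuclideanSpace ℝ (Fin 2)} (hp : deriv l (p 0 * p 1) = 0)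
    (h : EuclideanSpace ℝ (Fin 2)) :
    hessian (productLoss l) p h =
      (iteratedDeriv 2 l (p 0 * p 1) * (p 1 * h 0 + p 0 * h 1)) • !₂[p 1, p 0] := by
  have hd : Differentiable ℝ (deriv l) :=
    ((contDiff_succ_iff_deriv (n := 1)).1 hl).2.2.differentiable one_ne_zero
  rw [hessian, gradient_productLoss (hl.differentiable two_ne_zero)]
  have h0 := (EuclideanSpace.proj (𝕜 := ℝ) (0 : Fin 2)).hasFDerivAt (x := p)
  have h1 := (EuclideanSpace.proj (𝕜 := ℝ) (1 : Fin 2)).hasFDerivAt (x := p)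
  have hu := (hd _).hasDerivAt.comp_hasFDerivAt p (h0.mul h1)
  let S : EuclideanSpace ℝ (Fin 2) →L[ℝ] EuclideanSpace ℝ (Fin 2) :=
    ((EuclideanSpace.proj (𝕜 := ℝ) (1 : Fin 2)).smulRight !₂[(1 : ℝ), 0]) +
      ((EuclideanSpace.proj (𝕜 := ℝ) (0 : Fin 2)).smulRight !₂[(0 : ℝ), 1])
  have hS : ∀ p : EuclideanSpace ℝ (Fin 2), S p = !₂[p 1, p 0] := fun p => by
    ext i; fin_cases i <;> simp [S]
  have hf := hu.smul (S.hasFDerivAt (x := p))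
  have heq : (fun p : EuclideanSpace ℝ (Fin 2) => deriv l (p 0 * p 1) • !₂[p 1, p 0]) =
      fun p => deriv l (p 0 * p 1) • S p := by
    funext p; rw [hS]
  rw [heq]
  have hf' := hf.fderiv
  erw [hf']
  simp [hp, hS, iteratedDeriv_succ, iteratedDeriv_zero]
  congr 1
  ring

/-- The rank-one Hessian acts by l''·(x² + y²) along (y, x) and by zero on its orthogonal
complement; l'' ≥ 0 decides which is larger. -/
lemma isSharpness_productLoss {l : ℝ → ℝ} (hl : ContDiff ℝ 2 l)
    {p : EuclideanSpace ℝ (Fin 2)} (hp : deriv l (p 0 * p 1) = 0)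
    (h2 : 0 ≤ iteratedDeriv 2 l (p 0 * p 1)) (hp0 : 0 < p 0 ^ 2 + p 1 ^ 2) :
    IsSharpness (productLoss l) p (iteratedDeriv 2 l (p 0 * p 1) * (p 0 ^ 2 + p 1 ^ 2)) := by
  have hH := hessian_productLoss_apply hl hp
  set a := iteratedDeriv 2 l (p 0 * p 1)
  constructor
  · refine Module.End.hasEigenvalue_of_hasEigenvector (x := !₂[p 1, p 0]) ⟨?_, ?_⟩
    · rw [Module.End.mem_eigenspace_iff]
      change hessian (productLoss l) p _ = _
      rw [hH]
      congr 1
      change a * (p 1 * p 1 + p 0 * p 0) = _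
      ring
    · intro h
      have h0 := congrArg (fun q : EuclideanSpace ℝ (Fin 2) => q 0) h
      have h1 := congrArg (fun q : EuclideanSpace ℝ (Fin 2) => q 1) h
      simp at h0 h1
      rw [h0, h1] at hp0
      norm_num at hp0
  · intro μ hμ
    obtain ⟨h, hh⟩ := hμ.exists_hasEigenvector
    have hmem : hessian (productLoss l) p h = μ • h := hh.apply_eq_smul
    rw [hH] at hmem
    have h0 := congrArg (fun q : EuclideanSpace ℝ (Fin 2) => q 0) hmem
    have h1 := congrArg (fun q : EuclideanSpace ℝ (Fin 2) => q 1) hmem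
    simp at h0 h1
    by_cases hc : p 1 * h 0 + p 0 * h 1 = 0
    · rw [hc] at h0 h1
      have hμ0 : μ = 0 := by
        by_contra hne
        apply hh.2
        ext i
        fin_cases i
        · simpa [hne] using h0
        · simpa [hne] using h1
      rw [hμ0]
      positivity
    · refine le_of_eq (mul_right_cancel₀ hc ?_)
      linear_combination -p 1 * h0 - p 0 * h1

/-! ### Gradient descent as a slow passage, and the theorem. -/

/-- Supplies the a priori bound that `curvature_sub_drift` needs at initialization; at later times
it follows from |v| ≤ 1/2. -/
lemma one_le_sqrt_of_two_le_curvature {η a x y z : ℝ} (hη : 0 < η) (ha : 0 < a) (hw : |x * y - z| ≤ 1)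
    (hU : 4 * (2 * |z| + 1) * a ^ 2 * η ^ 2 ≤ 1) (hu : 2 ≤ η * a * (x ^ 2 + y ^ 2)) :
    1 ≤ η * a * √((x ^ 2 - y ^ 2) ^ 2 + 4 * z ^ 2) := by
  refine (sq_le_sq₀ zero_le_one (by positivity)).1 ?_
  rw [mul_pow, Real.sq_sqrt (by positivity)]
  have h1 : (x * y) ^ 2 - z ^ 2 ≤ 2 * |z| + 1 := by
    obtain ⟨w, hw'⟩ : ∃ w, w = x * y - z := ⟨_, rfl⟩
    have h2 : x * y = z + w := by linarith
    rw [← hw'] at hw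
    have h3 : (x * y) ^ 2 - z ^ 2 = w * (2 * z + w) := by rw [h2]; ring
    rw [h3]
    refine (le_abs_self _).trans ?_
    rw [abs_mul]
    have h4 : |2 * z + w| ≤ 2 * |z| + 1 := by
      refine (abs_add_le _ _).trans ?_
      rw [abs_mul, abs_two]; linarith
    calc |w| * |2 * z + w| ≤ 1 * (2 * |z| + 1) := by gcongr
      _ = _ := one_mul _
  have h5 : (η * a) ^ 2 * ((x ^ 2 - y ^ 2) ^ 2 + 4 * z ^ 2) =
      (η * a * (x ^ 2 + y ^ 2)) ^ 2 - 4 * (η * a) ^ 2 * ((x * y) ^ 2 - z ^ 2) := by ring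
  have h6 : 4 * (η * a) ^ 2 * ((x * y) ^ 2 - z ^ 2) ≤ 4 * (η * a) ^ 2 * (2 * |z| + 1) := by
    gcongr
  have h7 : (2 : ℝ) ^ 2 ≤ (η * a * (x ^ 2 + y ^ 2)) ^ 2 := by gcongr
  rw [h5]
  nlinarith

lemma gradientDescent_productLoss_succ {l : ℝ → ℝ} (hl : Differentiable ℝ l) (η : ℝ)
    (p₀ : EuclideanSpace ℝ (Fin 2)) (t : ℕ) :
    let p := gradientDescent (productLoss l) η p₀ t
    let p' := gradientDescent (productLoss l) η p₀ (t + 1)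
    p' 0 = p 0 - η * deriv l (p 0 * p 1) * p 1 ∧ p' 1 = p 1 - η * deriv l (p 0 * p 1) * p 0 ∧
      dist p p' = |η| * |deriv l (p 0 * p 1)| * √(p 0 ^ 2 + p 1 ^ 2) := by
  intro p p'
  have h : p' = p - η • (deriv l (p 0 * p 1) • !₂[p 1, p 0]) := by
    change p - η • gradient (productLoss l) p = _
    rw [gradient_productLoss hl]
  refine ⟨by rw [h]; simp [mul_assoc], by rw [h]; simp [mul_assoc], ?_⟩
  rw [h, dist_eq_norm, sub_sub_cancel, norm_smul, norm_smul, EuclideanSpace.norm_eq]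
  simp [Fin.sum_univ_two, mul_assoc, add_comm]

theorem mainTheorem2 (l : ℝ → ℝ) (zs : ℝ) (hl : ContDiff ℝ 5 l) (hmin : IsLocalMin l zs)
    (h2 : 0 < iteratedDeriv 2 l zs) (hα : 0 < productStability l zs) :
    ∃ η₀ σ τ δ C : ℝ, 0 < η₀ ∧ 0 < σ ∧ 0 < τ ∧ 0 < δ ∧ δ < τ ∧ 0 < C ∧
      ∀ η : ℝ, 0 < η → η ≤ η₀ →
        ∀ p₀ : EuclideanSpace ℝ (Fin 2),
          0 < |p₀ 0 * p₀ 1 - zs| → |p₀ 0 * p₀ 1 - zs| ≤ σ →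
          2 + δ ≤ η * iteratedDeriv 2 l zs * ((p₀ 0) ^ 2 + (p₀ 1) ^ 2) →
          η * iteratedDeriv 2 l zs * ((p₀ 0) ^ 2 + (p₀ 1) ^ 2) ≤ 2 + τ →
          ∃ (p : EuclideanSpace ℝ (Fin 2)) (lam : ℝ),
            Tendsto (gradientDescent (productLoss l) η p₀) atTop (𝓝 p) ∧
            p 0 * p 1 = zs ∧
            IsSharpness (productLoss l) p lam ∧
            |lam - (2 / η - 3 * (iteratedDeriv 2 l zs) ^ 4 / productStability l zs * η)|
              ≤ C * η ^ ((5 : ℝ) / 3) := by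
  have hg4 : ContDiff ℝ 4 (deriv l) := ((contDiff_succ_iff_deriv (n := 4)).1 hl).2.2
  have hld : Differentiable ℝ l := hl.differentiable (by norm_num)
  have hg0 : deriv l zs = 0 := hmin.deriv_eq_zero
  obtain ⟨a, ha⟩ : ∃ a, a = iteratedDeriv 2 l zs := ⟨_, rfl⟩
  obtain ⟨b, hb⟩ : ∃ b, b = iteratedDeriv 3 l zs := ⟨_, rfl⟩
  obtain ⟨c, hc⟩ : ∃ c, c = iteratedDeriv 4 l zs := ⟨_, rfl⟩
  obtain ⟨α, hαdef⟩ : ∃ α, α = productStability l zs := ⟨_, rfl⟩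
  have hαabc : α = 3 * b ^ 2 - c * a := by rw [hαdef, productStability, ← ha, ← hb, ← hc]
  rw [← hαdef] at hα ⊢
  rw [← ha] at h2 ⊢
  obtain ⟨C₀, ω₀, hC₀, hω₀, hω₁, hT⟩ := exists_cubic_taylor_bound hg4 zs
  have hd1 : deriv (deriv l) zs = a := by rw [ha, iteratedDeriv_succ, iteratedDeriv_one]
  rw [hg0, hd1, ← iteratedDeriv_succ', ← iteratedDeriv_succ', ← hb, ← hc] at hT
  simp only [zero_add] at hT
  have hKα : (b / a) ^ 2 - c / (3 * a) = α / (3 * a ^ 2) := by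
    rw [hαabc]; field_simp
  have hK : 0 < (b / a) ^ 2 - c / (3 * a) := by rw [hKα]; positivity
  obtain ⟨M, ρ, ω, η₀, hM, hρ, hρ2, hω, hωω, hβω, hη₀, hstep⟩ :=
    exists_gradient_slowStep h2 hC₀ hω₀ hω₁ hK hT
  obtain ⟨β, hβ⟩ : ∃ β, β = b / a := ⟨_, rfl⟩
  obtain ⟨K, hKdef⟩ : ∃ K, K = (b / a) ^ 2 - c / (3 * a) := ⟨_, rfl⟩
  rw [← hKdef] at hK hstep hKα
  rw [← hβ] at hstep hβω
  have hsK := Real.sqrt_pos.2 hK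
  obtain ⟨δ, τ, σ, e₀, C, hδ, hδτ, hσ, he₀, hC, hslow⟩ := slow_passage hM hρ
  obtain ⟨U, hU⟩ : ∃ U, U = 4 * (2 * |zs| + 1) * a ^ 2 := ⟨_, rfl⟩
  have hU0 : 0 < U := by rw [hU]; positivity
  obtain ⟨k, hk⟩ : ∃ k, k = a ^ 2 / K := ⟨_, rfl⟩
  have hk0 : 0 < k := by rw [hk]; positivity
  have hsk := Real.sqrt_pos.2 hk0
  have hτδ : 0 < τ - δ := by linarith
  obtain ⟨ηm, hηm, hηm0, hηm1, hηmk, hηmU, hηmτ⟩ : ∃ ηm, 0 < ηm ∧ ηm ≤ η₀ ∧ ηm ≤ 1 ∧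
      k * ηm ≤ e₀ ∧ U * ηm ≤ 1 ∧ U * ηm ≤ (τ - δ) / 3 := by
    have hle : ∀ {x m : ℝ}, 0 < x → ∀ {y}, m ≤ y / x → x * m ≤ y := fun hx _ h => by
      rwa [le_div_iff₀' hx] at h
    refine ⟨min (min η₀ 1) (min (e₀ / k) (min (1 / U) ((τ - δ) / 3 / U))), by positivity, ?_, ?_,
      hle hk0 ?_, hle hU0 ?_, hle hU0 ?_⟩ <;> simp
  -- The admissible window is the middle third of the one for v, since ηa(x² + y²) and 2 + v differ
  -- initially by at most (τ − δ)/3.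
  refine ⟨ηm, min ω (σ / (2 * √K)), (δ + 2 * τ) / 3, (2 * δ + τ) / 3, C * (k * √k), hηm,
    by positivity, by linarith, by linarith, by linarith, by positivity, ?_⟩
  intro η hη hηη p₀ hw0 hwσ hulow huupp
  have hη1 : η ≤ 1 := hηη.trans hηm1
  have hηsq : η ^ 2 ≤ ηm := by
    rw [sq]; exact (mul_le_of_le_one_left hη.le hη1).trans hηη
  have hUη : U * η ^ 2 ≤ 1 := le_trans (by gcongr) hηmU
  obtain ⟨e, he⟩ : ∃ e, e = a ^ 2 * η ^ 2 / K := ⟨_, rfl⟩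
  have hek : e = k * η ^ 2 := by rw [he, hk]; ring
  have he0 : 0 < e := by rw [hek]; positivity
  have hee₀ : e ≤ e₀ := by rw [hek]; exact le_trans (by gcongr) hηmk
  set P := gradientDescent (productLoss l) η p₀ with hP
  have hP0 : P 0 = p₀ := rfl
  set w : ℕ → ℝ := fun t => P t 0 * P t 1 - zs with hwdef
  set r : ℕ → ℝ := fun t => flipAmplitude K β (w t) with hrdef
  set v : ℕ → ℝ := fun t => driftParam η a zs (P t 0) (P t 1) with hvdef
  have hwr : ∀ t, |w t| ≤ ω → |w t| ≤ 2 / √K * r t := fun t ht =>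
    abs_le_flipAmplitude hK (le_trans (by gcongr) hβω)
  have hwω : |w 0| ≤ ω := hwσ.trans (min_le_left _ _)
  have hω1 : ω ≤ 1 := hωω.trans hω₁
  have hr0 : 0 < r 0 := by
    have h1 : 0 < 2 / √K * r 0 := hw0.trans_le (hwr 0 hwω)
    exact (mul_pos_iff_of_pos_left (by positivity)).1 h1
  have hrσ : r 0 ≤ σ := by
    calc r 0 ≤ √K * (2 * |w 0|) := by
          rw [hrdef]
          exact mul_le_mul_of_nonneg_left
            (norm_form_comparison (le_trans (by gcongr) hβω)).2 hsK.le
      _ ≤ √K * (2 * (σ / (2 * √K))) := by gcongr; exact hwσ.trans (min_le_right _ _)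
      _ = σ := by field_simp
  have huv : ∀ t, |w t| ≤ ω → 1 ≤ 2 + v t →
      |η * a * (P t 0 ^ 2 + P t 1 ^ 2) - (2 + v t)| ≤ U * η ^ 2 * |w t| := fun t ht hv => by
    have hvt : 2 + v t = η * a * √((P t 0 ^ 2 - P t 1 ^ 2) ^ 2 + 4 * zs ^ 2) := by
      simp only [hvdef, driftParam]; ring
    rw [hvt] at hv ⊢
    rw [hU]
    exact curvature_sub_drift hη h2 (ht.trans hω1) hv
  have hv0 : |η * a * (P 0 0 ^ 2 + P 0 1 ^ 2) - (2 + v 0)| ≤ (τ - δ) / 3 := by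
    refine (huv 0 hwω ?_).trans ?_
    · have := one_le_sqrt_of_two_le_curvature hη h2 (hwω.trans hω1) (by rwa [← hU]) (show
        2 ≤ η * a * (P 0 0 ^ 2 + P 0 1 ^ 2) by rw [hP0]; linarith)
      simp only [hvdef, driftParam]
      linarith
    · calc U * η ^ 2 * |w 0| ≤ U * ηm * 1 := by gcongr; exact hwω.trans hω1
        _ ≤ _ := by linarith
  rw [hP0] at hv0
  obtain ⟨hv01, hv02⟩ := abs_le.1 hv0
  have hsucc := gradientDescent_productLoss_succ hld η p₀
  rw [← hP] at hsucc
  -- The amplitude alone does not confine w, because w + βw²/2 has a second zero when β ≠ 0; hence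
  -- |w| ≤ ω is carried as the side condition.
  obtain ⟨hreg, hsum, vl, hvl, hvle⟩ := hslow e he0 hee₀ r v (fun t => |w t| ≤ ω) hwω hr0 hrσ
    (by linarith) (by linarith) (fun t hG _ hrρ hvρ => by
      obtain ⟨hx, hy, -⟩ := hsucc t
      rw [he]
      exact hstep η hη (hηη.trans hηm0) _ _ _ _ hx hy hG hrρ hvρ)
  have hv12 : ∀ t, -(1 / 2) ≤ v t ∧ v t ≤ 1 / 2 := fun t =>
    abs_le.1 ((hreg t).2.2.2.trans hρ2)
  have hvl2 : -(1 / 2) ≤ vl := ge_of_tendsto' hvl fun t => (hv12 t).1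
  have hwlim : Tendsto w atTop (𝓝 0) := by
    have := hsum.tendsto_atTop_zero.const_mul (2 / √K)
    rw [mul_zero] at this
    exact squeeze_zero_norm (fun t => hwr t (hreg t).1) this
  have hslim : Tendsto (fun t => η * a * (P t 0 ^ 2 + P t 1 ^ 2)) atTop (𝓝 (2 + vl)) := by
    have h1 : Tendsto (fun t => η * a * (P t 0 ^ 2 + P t 1 ^ 2) - (2 + v t)) atTop (𝓝 0) := by
      have := hwlim.abs.const_mul (U * η ^ 2)
      rw [abs_zero, mul_zero] at this
      exact squeeze_zero_norm (fun t => huv t (hreg t).1 (by linarith [(hv12 t).1])) this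
    have := h1.add (hvl.const_add 2)
    simpa using this
  have hsbound : ∀ t, P t 0 ^ 2 + P t 1 ^ 2 ≤ 4 / (η * a) := fun t => by
    rw [le_div_iff₀' (by positivity)]
    have h1 := (abs_le.1 (huv t (hreg t).1 (by linarith [(hv12 t).1]))).2
    have h3 : U * η ^ 2 * |w t| ≤ 1 * 1 := by gcongr; exact (hreg t).1.trans hω1
    linarith [(hv12 t).2]
  obtain ⟨Γ, hΓ⟩ : ∃ Γ, Γ = a + |b| + |c| + C₀ := ⟨_, rfl⟩
  have hgw : ∀ t, |deriv l (P t 0 * P t 1)| ≤ Γ * (2 / √K * r t) := fun t => by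
    have hΓ0 : 0 ≤ Γ := by rw [hΓ]; positivity
    have h1 := hT (w t) ((hreg t).1.trans hωω)
    rw [show zs + w t = P t 0 * P t 1 by simp only [hwdef]; ring] at h1
    have h3 := (expansion_bounds h2 hC₀ ((hreg t).1.trans hω1) h1).1
    rw [← hΓ] at h3
    exact h3.trans (by gcongr; exact hwr t (hreg t).1)
  -- Each step has length at most a constant times r, so summability of r gives a path of finite
  -- length.
  have hcauchy : CauchySeq P := by
    refine cauchySeq_of_summable_dist (Summable.of_nonneg_of_le (fun _ => dist_nonneg)
      (fun t => ?_) (hsum.mul_left (|η| * Γ * (2 / √K) * √(4 / (η * a)))))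
    calc dist (P t) (P (t + 1)) = |η| * |deriv l (P t 0 * P t 1)| * √(P t 0 ^ 2 + P t 1 ^ 2) :=
          (hsucc t).2.2
      _ ≤ |η| * (Γ * (2 / √K * r t)) * √(4 / (η * a)) := by
          have h0 := (abs_nonneg _).trans (hgw t)
          gcongr
          · exact hgw t
          · exact hsbound t
      _ = _ := by ring
  obtain ⟨p, hp⟩ := cauchySeq_tendsto_of_complete hcauchy
  have hcoord : ∀ i, Tendsto (fun t => P t i) atTop (𝓝 (p i)) := fun i =>
    ((EuclideanSpace.proj (𝕜 := ℝ) i).continuous.tendsto p).comp hp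
  have hpz : p 0 * p 1 = zs := by
    have h1 := tendsto_nhds_unique (((hcoord 0).mul (hcoord 1)).sub_const zs) hwlim
    linarith
  have hps : η * a * (p 0 ^ 2 + p 1 ^ 2) = 2 + vl :=
    tendsto_nhds_unique ((((hcoord 0).pow 2).add ((hcoord 1).pow 2)).const_mul (η * a)) hslim
  have hpos : 0 < p 0 ^ 2 + p 1 ^ 2 := by
    have h1 : 0 < η * a * (p 0 ^ 2 + p 1 ^ 2) := by rw [hps]; linarith
    exact (mul_pos_iff_of_pos_left (by positivity)).1 h1
  have hsharp := isSharpness_productLoss (hl.of_le (by norm_num)) (p := p) (by rw [hpz, hg0])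
    (by rw [hpz, ← ha]; exact h2.le) hpos
  rw [hpz, ← ha] at hsharp
  refine ⟨p, _, hp, hpz, hsharp, ?_⟩
  have hlam : a * (p 0 ^ 2 + p 1 ^ 2) - (2 / η - 3 * a ^ 4 / α * η) = (vl + e) / η := by
    have h1 : e = 3 * a ^ 4 / α * η ^ 2 := by rw [he, hKα]; field_simp
    rw [h1, eq_div_iff hη.ne']
    have h3 : (2 / η - 3 * a ^ 4 / α * η) * η = 2 - 3 * a ^ 4 / α * η ^ 2 := by
      field_simp
    rw [sub_mul, h3]
    linarith
  -- As e is a multiple of η², e^{3/2}/η is of order η²; η ≤ 1 then weakens the exponent to 5/3.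
  have hse : √e = √k * η := by rw [hek, Real.sqrt_mul hk0.le, Real.sqrt_sq hη.le]
  rw [hlam, abs_div, abs_of_pos hη]
  calc |vl + e| / η ≤ C * (e * √e) / η := by gcongr
    _ = C * (k * √k) * η ^ (2 : ℝ) := by
        rw [hse, hek, Real.rpow_two]; field_simp
    _ ≤ _ := by
        have := Real.rpow_le_rpow_of_exponent_ge hη hη1 (show (5 : ℝ) / 3 ≤ 2 by norm_num)
        gcongr
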